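/- Let $p,q\ge 2$, let $\Omega\subset\mathbb{R}^{p+q}=\mathbb{R}^p\times\mathbb{R}^q$ be a domain (non-empty, open, connected), and let $E\subset\Omega$ be closed in $\Omega$ with $\mathcal{H}^{p+q-1}(E)=0$, where $\mathcal{H}^{s}$ denotes $s$-dimensional Hausdorff measure. A function $u:U\to[-\infty,+\infty)$ on an open set $U\subset\mathbb{R}^n$ is called subharmonic if it is upper semicontinuous and its value at the center of each ball whose closure lies in $U$ is at most its mean over that ball with respect to Lebesgue measure (so $u\equiv-\infty$ on components of $U$ is allowed). A function $u:U\to[-\infty,+\infty)$ on an open set $U\subset\mathbb{R}^{p+q}$ is called separately subharmonic if for every $y\in\mathbb{R}^q$ the function $x\mapsto u(x,y)$ is subharmonic on $\{x\in\mathbb{R}^p:(x,y)\in U\}$, and for every $x\in\mathbb{R}^p$ the function $y\mapsto u(x,y)$ is subharmonic on $\{y\in\mathbb{R}^q:(x,y)\in U\}$. Let $w:\Omega\setminus E\to\mathbb{R}$ be separately subharmonic and suppose that (i) $w\in\mathcal{L}^1_{\mathrm{loc}}(\Omega)$; (ii) $w\in\mathcal{C}^2(\Omega\setminus E)$; (iii)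 $\frac{\partial^2 w}{\partial x_j^2}\in\mathcal{L}^1_{\mathrm{loc}}(\Omega)$ for each $1\le j\le p$, and $\frac{\partial^2 w}{\partial y_k^2}\in\mathcal{L}^1_{\mathrm{loc}}(\Omega)$ for each $1\le k\le q$. (Since $E$ has Lebesgue measure zero, (i) and (iii) make sense although $w$ and its derivatives are defined only on $\Omega\setminus E$.) Then $w$ has a separately subharmonic extension to $\Omega$, that is, there is a separately subharmonic function $W:\Omega\to[-\infty,+\infty)$ with $W=w$ on $\Omega\setminus E$. -/

import Mathlib

open Set MeasureTheory

noncomputable section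

namespace SepSubharmonic

/-- Mean value of an extended-real function over the open ball `B(a, r)` of `ℝⁿ` with respect to
Lebesgue measure: (average of `u⁺`) minus (average of `u⁻`), with `c - ∞ = -∞`. -/
def ballMean {n : ℕ} (u : EuclideanSpace ℝ (Fin n) → EReal)
    (a : EuclideanSpace ℝ (Fin n)) (r : ℝ) : EReal :=
  ((⨍⁻ z in Metric.ball a r, (u z).toENNReal ∂volume : ENNReal) : EReal) -
    ((⨍⁻ z in Metric.ball a r, (-(u z)).toENNReal ∂volume : ENNReal) : EReal)

/-- Subharmonic functions `u : U → [-∞, +∞)` on an open set `U ⊆ ℝⁿ`: upper semicontinuous with the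
sub-mean value inequality on every ball whose closure lies in `U`.
The value `-∞` is allowed, also identically on components of `U`. Only `u` on `U` matters. -/
structure SubharmonicOn {n : ℕ} (u : EuclideanSpace ℝ (Fin n) → EReal)
    (U : Set (EuclideanSpace ℝ (Fin n))) : Prop where
  lt_top : ∀ a ∈ U, u a < ⊤
  upperSemicontinuousOn : UpperSemicontinuousOn u U
  le_ballMean : ∀ (a : EuclideanSpace ℝ (Fin n)) (r : ℝ), 0 < r →
    Metric.closedBall a r ⊆ U → u a ≤ ballMean u a r

/-- The point `(x, y) ∈ ℝ^(p+q)` for `x ∈ ℝ^p`, `y ∈ ℝ^q`. -/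
def join {p q : ℕ} (x : EuclideanSpace ℝ (Fin p)) (y : EuclideanSpace ℝ (Fin q)) :
    EuclideanSpace ℝ (Fin (p + q)) :=
  WithLp.toLp 2 (Fin.append (fun i => x i) (fun j => y j))

/-- Separately subharmonic functions on an open set `U ⊆ ℝ^(p+q) = ℝ^p × ℝ^q`: for every `y` the
function `x ↦ w (x, y)` is subharmonic on the slice `U(y)`, and for every `x` the function
`y ↦ w (x, y)` is subharmonic on the slice `U(x)`. -/
def SeparatelySubharmonicOn (p q : ℕ) (w : EuclideanSpace ℝ (Fin (p + q)) → EReal)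
    (U : Set (EuclideanSpace ℝ (Fin (p + q)))) : Prop :=
  (∀ y : EuclideanSpace ℝ (Fin q),
    SubharmonicOn (fun x : EuclideanSpace ℝ (Fin p) => w (join x y)) {x | join x y ∈ U}) ∧
  (∀ x : EuclideanSpace ℝ (Fin p),
    SubharmonicOn (fun y : EuclideanSpace ℝ (Fin q) => w (join x y)) {y | join x y ∈ U})

/-- The partial derivative `∂f/∂z_i`. -/
def partialDeriv {n : ℕ} (i : Fin n) (f : EuclideanSpace ℝ (Fin n) → ℝ)
    (z : EuclideanSpace ℝ (Fin n)) : ℝ :=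
  lineDeriv ℝ f z (EuclideanSpace.single i 1)

end SepSubharmonic

end

open Filter Topology

set_option linter.unusedSectionVars false

namespace SepSubharmonic

/-! The extension is the infimum of the means of `w` over products of balls `B(x,r) × B(y,r)` inside
`Ω`, which are exactly the balls of the sup metric on `ℝ^p × ℝ^q`. Everything rests on one
monotonicity: the mean over `B(x,r) × B(y,s)` increases with `r` for fixed `s`, and with `s` for
fixed `r`.

For the monotonicity, take the compactly supported radial function `φ ≥ 0` on `ℝ^p` whose Laplacian
is the difference of the indicators of two concentric balls, normalised to equal mass, and multiply
it by the indicator of a ball in `ℝ^q`. Integrating by parts twice in the `x` variables turns the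
difference of two means, up to a positive factor, into the integral of `φ Δ_x w`, and `Δ_x w ≥ 0`
off the null set `E` because the slices of `w` are subharmonic and `C²`. The set `E` does not
obstruct the integration by parts: a coordinate projection is Lipschitz, so almost every line
parallel to an axis misses `E`. Along such a line `w` is `C²` where `φ` lives, and local
integrability of `w` and of its second derivatives justifies Fubini. No regularity in `y` is needed,
since only `x` derivatives occur (`integral_sub_integral_eq_integral_radialProfile`,
`inv_pow_mul_setIntegral_mono`).

Ball means of a function commute: `M_t M_r f = M_r M_t f`. If `M_t f` increases with `t`, then `M_r
f = lim M_t M_r f = lim M_r M_t f ≤ M_r M_s f = M_s M_r f` as `t → 0`, so `M_r f` has the sub-mean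
value property (`setAverage_ball_le_setAverage_ball`). In each group of variables, the mean over
products of balls of radius `δ` is thus continuous and subharmonic. As `δ ↓ 0` these means decrease
to the infimum, which is therefore separately subharmonic; where `w` is continuous, the limit is
`w`. -/

/-! ### Integration by parts along lines that miss the exceptional set. -/

/-- One-dimensional integration by parts, twice, against a compactly supported `φ`. -/
theorem integral_mul_sub_mul_eq_zero {w w₁ w₂ φ φ₁ φ₂ : ℝ → ℝ} {K S : Set ℝ}
    (hK : IsCompact K) (hS : S.Countable)
    (hw : ∀ t ∈ K, HasDerivAt w (w₁ t) t) (hw₁ : ∀ t ∈ K, HasDerivAt w₁ (w₂ t) t)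
    (hφ : ∀ t, HasDerivAt φ (φ₁ t) t) (hφ₁ : Continuous φ₁)
    (hφ₂ : ∀ t ∉ S, HasDerivAt φ₁ (φ₂ t) t)
    (hφK : ∀ t ∉ K, φ t = 0) (hφ₂K : ∀ t ∉ K, φ₂ t = 0)
    (hint : Integrable fun t => w t * φ₂ t - φ t * w₂ t) :
    ∫ t, (w t * φ₂ t - φ t * w₂ t) = 0 := by
  have hφ0 : ∀ t ∉ K, φ =ᶠ[𝓝 t] 0 := fun t ht => by
    filter_upwards [hK.isClosed.isOpen_compl.mem_nhds ht] with s hs using hφK s hs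
  have hφ₁K : ∀ t ∉ K, φ₁ t = 0 := fun t ht =>
    (hφ t).unique ((hasDerivAt_const t (0 : ℝ)).congr_of_eventuallyEq (hφ0 t ht))
  have hφ₁0 : ∀ t ∉ K, φ₁ =ᶠ[𝓝 t] 0 := fun t ht => by
    filter_upwards [hK.isClosed.isOpen_compl.mem_nhds ht] with s hs using hφ₁K s hs
  -- The integrand is the derivative of the Wronskian-type expression `H`, which vanishes off `K`;
  -- `w` need not be differentiable there.
  set H : ℝ → ℝ := fun t => w t * φ₁ t - φ t * w₁ t with hH
  have hH0 : ∀ t ∉ K, H =ᶠ[𝓝 t] fun _ => 0 := fun t ht => by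
    filter_upwards [hφ0 t ht, hφ₁0 t ht] with s h1 h2
    simp [hH, h1, h2]
  have hHK : ∀ t ∉ K, H t = 0 := fun t ht => (hH0 t ht).eq_of_nhds
  have hHcont : Continuous H := by
    rw [continuous_iff_continuousAt]
    intro t
    by_cases ht : t ∈ K
    · exact ((hw t ht).continuousAt.mul hφ₁.continuousAt).sub
        ((hφ t).continuousAt.mul (hw₁ t ht).continuousAt)
    · exact continuousAt_const.congr (hH0 t ht).symm
  have hHd : ∀ t ∉ S, HasDerivAt H (w t * φ₂ t - φ t * w₂ t) t := by
    intro t hts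
    by_cases ht : t ∈ K
    · exact (((hw t ht).mul (hφ₂ t hts)).sub ((hφ t).mul (hw₁ t ht))).congr_deriv (by ring)
    · exact ((hasDerivAt_const t (0 : ℝ)).congr_of_eventuallyEq (hH0 t ht)).congr_deriv
        (by simp [hφK t ht, hφ₂K t ht])
  obtain ⟨T, hT⟩ := hK.isBounded.subset_closedBall 0
  have hKT : ∀ t, |T| < |t| → t ∉ K := fun t ht htK => by
    have h1 := hT htK
    rw [mem_closedBall_zero_iff, Real.norm_eq_abs] at h1
    exact absurd (h1.trans (le_abs_self T)) (not_le.mpr ht)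
  set b := |T| + 1 with hb
  have hb0 : 0 < b := by positivity
  -- This form of the fundamental theorem needs only a continuous primitive, countably many
  -- exceptional points and an integrable derivative, so jumps of `φ₂` are harmless.
  have h1 := integral_eq_of_hasDerivAt_off_countable H (fun t => w t * φ₂ t - φ t * w₂ t)
    (a := -b) (b := b) hS hHcont.continuousOn (fun t ht => hHd t ht.2) hint.intervalIntegrable
  rw [hHK b (hKT b (by rw [abs_of_pos hb0]; linarith)),
    hHK (-b) (hKT (-b) (by rw [abs_neg, abs_of_pos hb0]; linarith)), sub_zero,
    intervalIntegral.integral_of_le (by linarith)] at h1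
  rw [← h1]
  refine (setIntegral_eq_integral_of_forall_compl_eq_zero fun t ht => ?_).symm
  have : t ∉ K := by
    apply hKT
    by_contra! hc
    refine ht ⟨?_, ?_⟩
    · linarith [neg_abs_le t]
    · linarith [le_abs_self t]
  simp [hφK t this, hφ₂K t this]

/-- The point of `ℝ^(m+1)` with `i`-th coordinate `t` and remaining coordinates `y`. -/
noncomputable def linePoint {m : ℕ} (i : Fin (m + 1)) (y : Fin m → ℝ) (t : ℝ) :
    EuclideanSpace ℝ (Fin (m + 1)) :=
  WithLp.toLp 2 (i.insertNth (α := fun _ => ℝ) t y)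

theorem linePoint_add {m : ℕ} (i : Fin (m + 1)) (y : Fin m → ℝ) (s t : ℝ) :
    linePoint i y s + t • EuclideanSpace.single i 1 = linePoint i y (s + t) := by
  ext k
  refine Fin.succAboveCases i ?_ (fun k => ?_) k
  · simp [linePoint]
  · simp [linePoint, Fin.succAbove_ne]

theorem continuous_linePoint {m : ℕ} (i : Fin (m + 1)) (y : Fin m → ℝ) :
    Continuous (linePoint i y) := by
  have : linePoint i y = fun t => linePoint i y 0 + t • EuclideanSpace.single i (1 : ℝ) := by
    ext1 t; rw [linePoint_add, zero_add]
  rw [this]; fun_prop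

theorem volume_preserving_linePoint {m : ℕ} (i : Fin (m + 1)) :
    MeasurePreserving (fun q : ℝ × (Fin m → ℝ) => linePoint i q.2 q.1)
      (volume.prod volume) volume :=
  (PiLp.volume_preserving_toLp (Fin (m + 1))).comp
    (volume_preserving_piFinSuccAbove (fun _ => ℝ) i).symm

theorem measurableEmbedding_linePoint {m : ℕ} (i : Fin (m + 1)) :
    MeasurableEmbedding (fun q : ℝ × (Fin m → ℝ) => linePoint i q.2 q.1) :=
  (MeasurableEquiv.toLp 2 (Fin (m + 1) → ℝ)).measurableEmbedding.comp
    (MeasurableEquiv.piFinSuccAbove (fun _ => ℝ) i).symm.measurableEmbedding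

/-- Fubini along the `i`-th axis. It also supplies integrability on almost every line, which is why
the hypothesis on lines may assume it. -/
theorem integral_eq_zero_of_ae_linePoint {m : ℕ} (i : Fin (m + 1))
    {F : EuclideanSpace ℝ (Fin (m + 1)) → ℝ} (hF : Integrable F)
    (h : ∀ᵐ y : Fin m → ℝ, Integrable (fun t => F (linePoint i y t)) →
      ∫ t, F (linePoint i y t) = 0) : ∫ z, F z = 0 := by
  have hp := volume_preserving_linePoint i
  have he := measurableEmbedding_linePoint i
  rw [← hp.integral_comp he]
  have hF' : Integrable (fun q : ℝ × (Fin m → ℝ) => F (linePoint i q.2 q.1))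
      (volume.prod volume) := (hp.integrable_comp_emb he).2 hF
  rw [integral_prod_symm _ hF']
  refine integral_eq_zero_of_ae ?_
  filter_upwards [h, hF'.prod_left_ae] with y h1 h2 using h1 h2

/-- Almost every line parallel to a coordinate axis misses a set of vanishing Hausdorff measure
of codimension one. -/
theorem ae_linePoint_notMem {m : ℕ} (i : Fin (m + 1))
    {E : Set (EuclideanSpace ℝ (Fin (m + 1)))} (hE : Measure.hausdorffMeasure (m : ℝ) E = 0) :
    ∀ᵐ y : Fin m → ℝ, ∀ t, linePoint i y t ∉ E := by
  set P : EuclideanSpace ℝ (Fin (m + 1)) → (Fin m → ℝ) := fun z => i.removeNth (WithLp.ofLp z)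
    with hP
  have hLip : LipschitzWith 1 P := by
    have h1 : LipschitzWith 1 (fun f : Fin (m + 1) → ℝ => (i.removeNth f : Fin m → ℝ)) := by
      refine LipschitzWith.of_dist_le_mul fun f g => ?_
      rw [NNReal.coe_one, one_mul, dist_pi_le_iff dist_nonneg]
      intro k
      exact dist_le_pi_dist f g (i.succAbove k)
    have h2 := h1.comp (PiLp.lipschitzWith_ofLp 2 (fun _ : Fin (m + 1) => ℝ))
    rwa [one_mul] at h2
  -- In the sup metric on `Fin m → ℝ`, the measure `ℋ^m` is exactly Lebesgue measure, so the
  -- 1-Lipschitz image of `E` is Lebesgue null.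
  have h0 : volume (P '' E) = 0 := by
    have := hLip.hausdorffMeasure_image_le (Nat.cast_nonneg m) E
    rw [hE, mul_zero, nonpos_iff_eq_zero] at this
    rw [← hausdorffMeasure_pi_real, Fintype.card_fin]
    exact this
  filter_upwards [measure_eq_zero_iff_ae_notMem.1 h0] with y hy t ht
  refine hy ⟨_, ht, ?_⟩
  simp [hP, linePoint]

/-- A line derivative in a coordinate direction, read along a line. -/
theorem hasDerivAt_linePoint {m : ℕ} {i : Fin (m + 1)}
    {f : EuclideanSpace ℝ (Fin (m + 1)) → ℝ} {f' : ℝ} {y : Fin m → ℝ} {t : ℝ}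
    (h : HasLineDerivAt ℝ f f' (linePoint i y t) (EuclideanSpace.single i 1)) :
    HasDerivAt (fun s => f (linePoint i y s)) f' t := by
  unfold HasLineDerivAt at h
  simp only [linePoint_add] at h
  have h' : HasDerivAt (fun s => f (linePoint i y (t + s))) f' (t - t) := by
    simpa using h
  have := h'.comp_sub_const t t
  simpa using this

theorem hasLineDerivAt_of_contDiffOn {n : ℕ} {U : Set (EuclideanSpace ℝ (Fin n))} (hU : IsOpen U)
    {w : EuclideanSpace ℝ (Fin n) → ℝ} (hw : ContDiffOn ℝ 2 w U) (i : Fin n)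
    {z : EuclideanSpace ℝ (Fin n)} (hz : z ∈ U) :
    HasLineDerivAt ℝ w (partialDeriv i w z) z (EuclideanSpace.single i 1) :=
  (((hw.contDiffAt (hU.mem_nhds hz)).differentiableAt
    (by norm_num)).lineDifferentiableAt).hasLineDerivAt

theorem contDiffOn_partialDeriv {n : ℕ} {U : Set (EuclideanSpace ℝ (Fin n))} (hU : IsOpen U)
    {w : EuclideanSpace ℝ (Fin n) → ℝ} (hw : ContDiffOn ℝ 2 w U) (i : Fin n) :
    ContDiffOn ℝ 1 (partialDeriv i w) U := by
  have h1 : ContDiffOn ℝ 1 (fun z => fderiv ℝ w z (EuclideanSpace.single i 1)) U :=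
    (hw.fderiv_of_isOpen hU (by norm_num)).clm_apply contDiffOn_const
  refine h1.congr fun z hz => ?_
  exact ((hw.contDiffAt (hU.mem_nhds hz)).differentiableAt (by norm_num)).lineDeriv_eq_fderiv

theorem hasLineDerivAt_partialDeriv {n : ℕ} {U : Set (EuclideanSpace ℝ (Fin n))} (hU : IsOpen U)
    {w : EuclideanSpace ℝ (Fin n) → ℝ} (hw : ContDiffOn ℝ 2 w U) (i : Fin n)
    {z : EuclideanSpace ℝ (Fin n)} (hz : z ∈ U) :
    HasLineDerivAt ℝ (partialDeriv i w) (partialDeriv i (partialDeriv i w) z) z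
      (EuclideanSpace.single i 1) :=
  ((((contDiffOn_partialDeriv hU hw i).contDiffAt (hU.mem_nhds hz)).differentiableAt
    (by norm_num)).lineDifferentiableAt).hasLineDerivAt

theorem continuousOn_partialDeriv_partialDeriv {n : ℕ} {U : Set (EuclideanSpace ℝ (Fin n))}
    (hU : IsOpen U) {w : EuclideanSpace ℝ (Fin n) → ℝ} (hw : ContDiffOn ℝ 2 w U) (i : Fin n) :
    ContinuousOn (partialDeriv i (partialDeriv i w)) U := by
  have h1 : ContDiffOn ℝ 0
      (fun z => fderiv ℝ (partialDeriv i w) z (EuclideanSpace.single i 1)) U :=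
    ((contDiffOn_partialDeriv hU hw i).fderiv_of_isOpen hU (by norm_num)).clm_apply
      contDiffOn_const
  refine h1.continuousOn.congr fun z hz => ?_
  exact (((contDiffOn_partialDeriv hU hw i).contDiffAt (hU.mem_nhds hz)).differentiableAt
    (by norm_num)).lineDeriv_eq_fderiv

/-- Integration by parts across a closed set of vanishing Hausdorff measure of codimension one. -/
theorem integral_mul_eq_integral_mul_partialDeriv {n : ℕ} (i : Fin n)
    {Ω E K : Set (EuclideanSpace ℝ (Fin n))} (hΩE : IsOpen (Ω \ E))
    (hE : Measure.hausdorffMeasure ((n : ℝ) - 1) E = 0) (hK : IsCompact K) (hKΩ : K ⊆ Ω)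
    {w φ φ₁ φ₂ : EuclideanSpace ℝ (Fin n) → ℝ} (hw : ContDiffOn ℝ 2 w (Ω \ E))
    (hφ : ∀ z, HasLineDerivAt ℝ φ (φ₁ z) z (EuclideanSpace.single i 1))
    (hφ₁ : ∀ z, Continuous fun t : ℝ => φ₁ (z + t • EuclideanSpace.single i 1))
    (hφ₂ : ∀ z, {t : ℝ | ¬ HasLineDerivAt ℝ φ₁ (φ₂ (z + t • EuclideanSpace.single i 1))
      (z + t • EuclideanSpace.single i 1) (EuclideanSpace.single i 1)}.Countable)
    (hφK : ∀ z ∉ K, φ z = 0) (hφ₂K : ∀ z ∉ K, φ₂ z = 0)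
    (hi₁ : Integrable fun z => w z * φ₂ z)
    (hi₂ : Integrable fun z => φ z * partialDeriv i (partialDeriv i w) z) :
    ∫ z, w z * φ₂ z = ∫ z, φ z * partialDeriv i (partialDeriv i w) z := by
  obtain _ | m := n
  · exact i.elim0
  have hE' : Measure.hausdorffMeasure (m : ℝ) E = 0 := by
    rw [← hE]; congr; push_cast; ring
  rw [← sub_eq_zero, ← integral_sub hi₁ hi₂]
  refine integral_eq_zero_of_ae_linePoint i (hi₁.sub hi₂) ?_
  filter_upwards [ae_linePoint_notMem i hE'] with y hy hint
  have hc := continuous_linePoint i y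
  have hKc : IsCompact (linePoint i y ⁻¹' K) := by
    refine Metric.isCompact_of_isClosed_isBounded (hK.isClosed.preimage hc) ?_
    obtain ⟨T, hT⟩ := hK.isBounded.subset_closedBall 0
    refine (Metric.isBounded_closedBall (x := (0 : ℝ)) (r := T)).subset fun t ht => ?_
    have h1 := hT ht
    rw [mem_closedBall_zero_iff] at h1 ⊢
    refine le_trans ?_ h1
    have := PiLp.norm_apply_le (linePoint i y t) i
    simpa [linePoint] using this
  refine integral_mul_sub_mul_eq_zero (K := linePoint i y ⁻¹' K)
    (w₁ := fun t => partialDeriv i w (linePoint i y t))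
    (φ₁ := fun t => φ₁ (linePoint i y t)) hKc (hφ₂ (linePoint i y 0)) ?_ ?_ ?_ ?_ ?_ ?_ ?_ hint
  · exact fun t ht => hasDerivAt_linePoint (hasLineDerivAt_of_contDiffOn hΩE hw i ⟨hKΩ ht, hy t⟩)
  · exact fun t ht => hasDerivAt_linePoint (hasLineDerivAt_partialDeriv hΩE hw i ⟨hKΩ ht, hy t⟩)
  · exact fun t => hasDerivAt_linePoint (hφ _)
  · have h1 := hφ₁ (linePoint i y 0)
    simp only [linePoint_add, zero_add] at h1
    exact h1
  · intro t ht
    simp only [mem_ofPred_eq, not_not, linePoint_add, zero_add] at ht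
    exact hasDerivAt_linePoint ht
  · exact fun t ht => hφK _ ht
  · exact fun t ht => hφ₂K _ ht

/-! ### The radial test function. -/

/-- Derivative of `radialProfile`. -/
noncomputable def radialProfileDeriv (e A B t : ℝ) : ℝ :=
  (max B t ^ (-e) - max A t ^ (-e)) / (4 * e)

/-- With `e = d / 2`, the function `x ↦ radialProfile e A B (‖x‖ ^ 2)` on `ℝ^d` is the nonnegative
compactly supported function whose Laplacian is the difference of the constant `B ^ (-e)` on the
ball of radius `√B` and the constant `A ^ (-e)` on the ball of radius `√A`. -/
noncomputable def radialProfile (e A B t : ℝ) : ℝ :=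
  ∫ s in B..t, radialProfileDeriv e A B s

/-- Second derivative of `radialProfile`, away from `A` and `B`. -/
noncomputable def radialProfileDeriv₂ (e A B t : ℝ) : ℝ :=
  (Ico A B).indicator (fun t => t ^ (-e - 1) / 4) t

section profile

variable {e A B : ℝ}

theorem continuous_radialProfileDeriv (hA : 0 < A) (hAB : A ≤ B) :
    Continuous (radialProfileDeriv e A B) := by
  unfold radialProfileDeriv
  refine Continuous.div_const (Continuous.sub ?_ ?_) _
  · exact (continuous_const.max continuous_id).rpow_const
      fun t => Or.inl ((hA.trans_le hAB).trans_le (le_max_left _ _)).ne'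
  · exact (continuous_const.max continuous_id).rpow_const
      fun t => Or.inl (hA.trans_le (le_max_left _ _)).ne'

theorem hasDerivAt_radialProfile (hA : 0 < A) (hAB : A ≤ B) (t : ℝ) :
    HasDerivAt (radialProfile e A B) (radialProfileDeriv e A B t) t :=
  (continuous_radialProfileDeriv hA hAB).integral_hasStrictDerivAt B t |>.hasDerivAt

theorem radialProfileDeriv_eq_zero (hAB : A ≤ B) {t : ℝ} (ht : B ≤ t) :
    radialProfileDeriv e A B t = 0 := by
  simp [radialProfileDeriv, max_eq_right ht, max_eq_right (hAB.trans ht)]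

theorem radialProfileDeriv_nonpos (he : 0 < e) (hA : 0 < A) (hAB : A ≤ B) (t : ℝ) :
    radialProfileDeriv e A B t ≤ 0 := by
  refine div_nonpos_of_nonpos_of_nonneg (sub_nonpos.2 ?_) (by positivity)
  exact Real.rpow_le_rpow_of_nonpos (hA.trans_le (le_max_left _ _))
    (max_le_max hAB le_rfl) (by linarith)

theorem radialProfileDeriv_neg (he : 0 < e) (hA : 0 < A) (hAB : A < B) {t : ℝ} (ht : t < B) :
    radialProfileDeriv e A B t < 0 := by
  refine div_neg_of_neg_of_pos (sub_neg.2 ?_) (by positivity)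
  refine Real.rpow_lt_rpow_of_neg (hA.trans_le (le_max_left _ _)) ?_ (by linarith)
  rw [max_eq_left ht.le]; exact max_lt hAB ht

theorem abs_radialProfileDeriv_le (he : 0 < e) (hA : 0 < A) (hAB : A ≤ B) (t : ℝ) :
    |radialProfileDeriv e A B t| ≤ A ^ (-e) / (4 * e) := by
  rw [abs_of_nonpos (radialProfileDeriv_nonpos he hA hAB t), radialProfileDeriv, ← neg_div]
  gcongr
  have h1 : 0 < max B t ^ (-e) :=
    Real.rpow_pos_of_pos ((hA.trans_le hAB).trans_le (le_max_left _ _)) _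
  have h2 : max A t ^ (-e) ≤ A ^ (-e) :=
    Real.rpow_le_rpow_of_nonpos hA (le_max_left _ _) (by linarith)
  linarith

theorem radialProfile_eq_zero (hAB : A ≤ B) {t : ℝ} (ht : B ≤ t) :
    radialProfile e A B t = 0 := by
  refine intervalIntegral.integral_zero_ae (ae_of_all _ fun s hs => ?_)
  rw [uIoc_of_le ht] at hs
  exact radialProfileDeriv_eq_zero hAB hs.1.le

theorem radialProfile_nonneg (he : 0 < e) (hA : 0 < A) (hAB : A ≤ B) (t : ℝ) :
    0 ≤ radialProfile e A B t := by
  rcases le_total B t with ht | ht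
  · rw [radialProfile_eq_zero hAB ht]
  · rw [radialProfile, intervalIntegral.integral_symm, ← intervalIntegral.integral_neg]
    exact intervalIntegral.integral_nonneg ht fun s _ =>
      neg_nonneg.2 (radialProfileDeriv_nonpos he hA hAB s)

theorem radialProfile_pos (he : 0 < e) (hA : 0 < A) (hAB : A < B) {t : ℝ} (ht : t < B) :
    0 < radialProfile e A B t := by
  rw [radialProfile, intervalIntegral.integral_symm, ← intervalIntegral.integral_neg]
  refine intervalIntegral.intervalIntegral_pos_of_pos_on
    ((continuous_radialProfileDeriv hA hAB.le).neg.intervalIntegrable _ _) (fun s hs => ?_) ht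
  exact neg_pos.2 (radialProfileDeriv_neg he hA hAB hs.2)

theorem hasDerivAt_radialProfileDeriv (he : 0 < e) (hA : 0 < A) (hAB : A ≤ B) {t : ℝ}
    (htA : t ≠ A) (htB : t ≠ B) :
    HasDerivAt (radialProfileDeriv e A B) (radialProfileDeriv₂ e A B t) t := by
  rcases lt_or_gt_of_ne htB with h | h
  · rcases lt_or_gt_of_ne htA with h' | h'
    · rw [radialProfileDeriv₂, indicator_of_notMem (fun h2 => absurd h2.1 (not_le.2 h'))]
      refine (hasDerivAt_const t ((B ^ (-e) - A ^ (-e)) / (4 * e))).congr_of_eventuallyEq ?_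
      filter_upwards [Iio_mem_nhds h, Iio_mem_nhds h'] with s h1 h2
      rw [radialProfileDeriv, max_eq_left (le_of_lt h1), max_eq_left (le_of_lt h2)]
    · rw [radialProfileDeriv₂, indicator_of_mem (show t ∈ Ico A B from ⟨h'.le, h⟩)]
      have h1 : HasDerivAt (fun s : ℝ => (B ^ (-e) - s ^ (-e)) / (4 * e))
          ((0 - (-e) * t ^ (-e - 1)) / (4 * e)) t :=
        ((hasDerivAt_const t _).sub
          (Real.hasDerivAt_rpow_const (Or.inl (hA.trans h').ne'))).div_const _
      refine (h1.congr_of_eventuallyEq ?_).congr_deriv (by field_simp; ring)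
      filter_upwards [Iio_mem_nhds h, Ioi_mem_nhds h'] with s h1 h2
      rw [radialProfileDeriv, max_eq_left (le_of_lt h1), max_eq_right (le_of_lt h2)]
  · rw [radialProfileDeriv₂, indicator_of_notMem (fun h2 => absurd h2.2 (not_lt.2 h.le))]
    refine (hasDerivAt_const t (0 : ℝ)).congr_of_eventuallyEq ?_
    filter_upwards [Ioi_mem_nhds h] with s hs using radialProfileDeriv_eq_zero hAB (le_of_lt hs)

/-- For `φ(x) = ψ(‖x‖²)` on `ℝ^d` one has `Δφ = 4tψ'' + 2dψ'` at `t = ‖x‖²`, and `2d = 4e`. The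
half-open interval in `radialProfileDeriv₂` makes the identity hold at every `t`, including the
kinks `A` and `B`. -/
theorem radialProfile_laplacian (he : 0 < e) (hA : 0 < A) (hAB : A ≤ B) (t : ℝ) :
    4 * t * radialProfileDeriv₂ e A B t + 4 * e * radialProfileDeriv e A B t =
      B ^ (-e) * (Iio B).indicator 1 t - A ^ (-e) * (Iio A).indicator 1 t := by
  have h4 : 4 * e * radialProfileDeriv e A B t = max B t ^ (-e) - max A t ^ (-e) := by
    rw [radialProfileDeriv]; field_simp
  rw [h4, radialProfileDeriv₂]
  rcases lt_or_ge t B with h | h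
  · rcases lt_or_ge t A with h' | h'
    · simp [indicator, h, h', not_le.2 h', h.le, h'.le]
    · have ht : 0 < t := hA.trans_le h'
      have : t * t ^ (-e - 1) = t ^ (-e) := by
        rw [Real.rpow_sub_one ht.ne']; field_simp
      simp only [indicator, mem_Ico, h, h', mem_Iio, not_lt.2 h', max_eq_left h.le,
        max_eq_right h']
      simp
      linarith
  · simp [indicator, not_lt.2 h, not_lt.2 (hAB.trans h), max_eq_right h,
      max_eq_right (hAB.trans h)]

theorem abs_radialProfileDeriv₂_le (he : 0 < e) (hA : 0 < A) (t : ℝ) :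
    |radialProfileDeriv₂ e A B t| ≤ A ^ (-e - 1) / 4 := by
  rw [radialProfileDeriv₂, indicator]
  split_ifs with h
  · rw [abs_of_nonneg (by have := hA.trans_le h.1; positivity)]
    gcongr ?_ / 4
    exact Real.rpow_le_rpow_of_nonpos hA h.1 (by linarith)
  · rw [abs_zero]; positivity

theorem radialProfileDeriv₂_eq_zero {t : ℝ} (ht : B ≤ t) :
    radialProfileDeriv₂ e A B t = 0 :=
  indicator_of_notMem (fun h => absurd h.2 (not_lt.2 ht)) _

theorem measurable_radialProfileDeriv₂ : Measurable (radialProfileDeriv₂ e A B) := by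
  unfold radialProfileDeriv₂
  exact Measurable.indicator (by fun_prop) measurableSet_Ico

end profile

/-! ### Green's identity in a group of coordinates. -/

theorem integrable_mul_of_bound {α : Type*} [MeasurableSpace α] {μ : Measure α} {K : Set α}
    (hK : MeasurableSet K) {f g : α → ℝ} (hf : IntegrableOn f K μ) (hg : Measurable g)
    (hgK : ∀ z ∉ K, g z = 0) {C : ℝ} (hC : ∀ z, |g z| ≤ C) :
    Integrable (fun z => f z * g z) μ := by
  have h1 : Integrable (fun z => K.indicator f z * g z) μ :=
    (hf.integrable_indicator hK).mul_bdd hg.aestronglyMeasurable (ae_of_all _ hC)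
  refine h1.congr (ae_of_all _ fun z => ?_)
  by_cases hz : z ∈ K
  · simp [hz]
  · simp [hz, hgK z hz]

/-- Squared distance of `z` to `a` in the coordinates of `J`. -/
noncomputable def coordSq {n : ℕ} (J : Finset (Fin n)) (a z : EuclideanSpace ℝ (Fin n)) : ℝ :=
  ∑ j ∈ J, (z j - a j) ^ 2

section coordSq

variable {n : ℕ} {J : Finset (Fin n)} {a : EuclideanSpace ℝ (Fin n)}

theorem coordSq_nonneg (z : EuclideanSpace ℝ (Fin n)) : 0 ≤ coordSq J a z :=
  Finset.sum_nonneg fun _ _ => sq_nonneg _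

theorem sq_le_coordSq {j : Fin n} (hj : j ∈ J) (z : EuclideanSpace ℝ (Fin n)) :
    (z j - a j) ^ 2 ≤ coordSq J a z :=
  Finset.single_le_sum (f := fun j => (z j - a j) ^ 2) (fun _ _ => sq_nonneg _) hj

theorem continuous_coordSq : Continuous (coordSq J a) := by
  unfold coordSq; fun_prop

theorem coordSq_add_smul {j : Fin n} (hj : j ∈ J) (z : EuclideanSpace ℝ (Fin n)) (t : ℝ) :
    coordSq J a (z + t • EuclideanSpace.single j 1) =
      coordSq J a z + 2 * t * (z j - a j) + t ^ 2 := by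
  rw [coordSq, coordSq, ← Finset.add_sum_erase _ _ hj, ← Finset.add_sum_erase _ _ hj]
  have : ∀ k ∈ J.erase j, ((z + t • EuclideanSpace.single j (1 : ℝ)) k - a k) ^ 2
      = (z k - a k) ^ 2 := by
    intro k hk
    simp [Finset.ne_of_mem_erase hk]
  rw [Finset.sum_congr rfl this]
  simp; ring

theorem hasLineDerivAt_coordSq {j : Fin n} (hj : j ∈ J) (z : EuclideanSpace ℝ (Fin n)) :
    HasLineDerivAt ℝ (coordSq J a) (2 * (z j - a j)) z (EuclideanSpace.single j 1) := by
  unfold HasLineDerivAt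
  simp only [coordSq_add_smul hj]
  have h := (((hasDerivAt_id (0 : ℝ)).const_mul 2).mul_const (z j - a j)).const_add
    (coordSq J a z) |>.add ((hasDerivAt_id (0 : ℝ)).pow 2)
  exact h.congr_deriv (by simp)

/-- Along a line in a direction of `J` the squared distance is a monic quadratic, so the kinks of
the test function are met at most finitely often. -/
theorem countable_coordSq_eq {j : Fin n} (hj : j ∈ J) (z : EuclideanSpace ℝ (Fin n)) (A : ℝ) :
    {t : ℝ | coordSq J a (z + t • EuclideanSpace.single j 1) = A}.Countable := by
  simp only [coordSq_add_smul hj]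
  set c := z j - a j
  refine Set.Countable.mono (s₂ := {-c + √(c ^ 2 + A - coordSq J a z),
    -c - √(c ^ 2 + A - coordSq J a z)}) (fun t ht => ?_) (Set.toFinite _).countable
  simp only [mem_ofPred_eq] at ht
  have h1 : (t + c) ^ 2 = c ^ 2 + A - coordSq J a z := by rw [← ht]; ring
  rw [← h1, Real.sqrt_sq_eq_abs]
  rcases abs_cases (t + c) with ⟨h, -⟩ | ⟨h, -⟩ <;> simp [h]

end coordSq

/-- A set invariant under translation in direction `j` has an indicator constant along these lines,
so cutting off by it commutes with `∂_j`. -/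
theorem indicator_hasLineDerivAt {n : ℕ} {L : Set (EuclideanSpace ℝ (Fin n))} {j : Fin n}
    (hL : ∀ z (t : ℝ), z + t • EuclideanSpace.single j 1 ∈ L ↔ z ∈ L)
    {f f' : EuclideanSpace ℝ (Fin n) → ℝ} {z : EuclideanSpace ℝ (Fin n)}
    (hf : HasLineDerivAt ℝ f (f' z) z (EuclideanSpace.single j 1)) :
    HasLineDerivAt ℝ (L.indicator f) (L.indicator f' z) z (EuclideanSpace.single j 1) := by
  unfold HasLineDerivAt at hf ⊢
  by_cases hz : z ∈ L
  · simp only [indicator, hL, hz, if_true]; exact hf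
  · simp only [indicator, hL, hz, if_false]; exact hasDerivAt_const _ _

/-- Green's identity for the difference of the mean values of `w` over two concentric balls in the
coordinates of `J`, across a closed set `E` of vanishing Hausdorff measure of codimension one. -/
theorem integral_sub_integral_eq_integral_radialProfile {n : ℕ} {J : Finset (Fin n)}
    (hJ : J.Nonempty) {a : EuclideanSpace ℝ (Fin n)} {Ω E K L : Set (EuclideanSpace ℝ (Fin n))}
    (hΩE : IsOpen (Ω \ E)) (hE : Measure.hausdorffMeasure ((n : ℝ) - 1) E = 0)
    (hK : IsCompact K) (hKΩ : K ⊆ Ω) (hL : MeasurableSet L)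
    (hLJ : ∀ j ∈ J, ∀ z (t : ℝ), z + t • EuclideanSpace.single j 1 ∈ L ↔ z ∈ L)
    {e A B : ℝ} (he : 2 * e = J.card) (hA : 0 < A) (hAB : A ≤ B)
    (hLK : L ∩ {z | coordSq J a z < B} ⊆ K)
    {w : EuclideanSpace ℝ (Fin n) → ℝ} (hw : ContDiffOn ℝ 2 w (Ω \ E)) (hwK : IntegrableOn w K)
    (hw₂K : ∀ j ∈ J, IntegrableOn (partialDeriv j (partialDeriv j w)) K) :
    B ^ (-e) * (∫ z in L ∩ {z | coordSq J a z < B}, w z) -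
      A ^ (-e) * (∫ z in L ∩ {z | coordSq J a z < A}, w z) =
    ∫ z, L.indicator (fun z => radialProfile e A B (coordSq J a z)) z *
      ∑ j ∈ J, partialDeriv j (partialDeriv j w) z := by
  have he0 : 0 < e := by
    have : (0 : ℝ) < J.card := by exact_mod_cast hJ.card_pos
    linarith
  have hsq := continuous_coordSq (J := J) (a := a)
  have hD := continuous_radialProfileDeriv (e := e) hA hAB
  set φ : EuclideanSpace ℝ (Fin n) → ℝ :=
    L.indicator (fun z => radialProfile e A B (coordSq J a z)) with hφ
  set φ₁ : Fin n → EuclideanSpace ℝ (Fin n) → ℝ := fun j =>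
    L.indicator (fun z => radialProfileDeriv e A B (coordSq J a z) * (2 * (z j - a j))) with hφ₁
  set φ₂ : Fin n → EuclideanSpace ℝ (Fin n) → ℝ := fun j =>
    L.indicator (fun z => radialProfileDeriv₂ e A B (coordSq J a z) * (2 * (z j - a j)) ^ 2 +
      radialProfileDeriv e A B (coordSq J a z) * 2) with hφ₂
  have hoff : ∀ z ∉ K, z ∈ L → B ≤ coordSq J a z := fun z hz hzL => by
    by_contra! h
    exact hz (hLK ⟨hzL, h⟩)
  have hφK : ∀ z ∉ K, φ z = 0 := fun z hz => by
    by_cases hzL : z ∈ L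
    · rw [hφ, indicator_of_mem hzL, radialProfile_eq_zero hAB (hoff z hz hzL)]
    · rw [hφ, indicator_of_notMem hzL]
  have hφ₂K : ∀ j, ∀ z ∉ K, φ₂ j z = 0 := fun j z hz => by
    by_cases hzL : z ∈ L
    · simp only [hφ₂, indicator_of_mem hzL, radialProfileDeriv₂_eq_zero (hoff z hz hzL),
        radialProfileDeriv_eq_zero hAB (hoff z hz hzL)]
      simp
    · simp only [hφ₂, indicator_of_notMem hzL]
  have hi₁ : ∀ j ∈ J, Integrable fun z => w z * φ₂ j z := by
    intro j hj
    -- The factor `4 * B` bounds `(2 * (z j - a j)) ^ 2` where `coordSq J a z < B`; elsewhere both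
    -- profile derivatives vanish.
    refine integrable_mul_of_bound hK.measurableSet hwK ?_ (hφ₂K j)
      (C := A ^ (-e - 1) / 4 * (4 * B) + A ^ (-e) / (4 * e) * 2) (fun z => ?_)
    · refine Measurable.indicator ?_ hL
      refine ((measurable_radialProfileDeriv₂.comp hsq.measurable).mul (by fun_prop)).add
        ((hD.comp hsq).measurable.mul_const _)
    · have hB0 : 0 < B := hA.trans_le hAB
      have hpos : 0 ≤ A ^ (-e - 1) / 4 * (4 * B) + A ^ (-e) / (4 * e) * 2 := by positivity
      simp only [hφ₂, indicator]
      split_ifs with hzL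
      · rcases lt_or_ge (coordSq J a z) B with h | h
        · refine (abs_add_le _ _).trans (add_le_add ?_ ?_)
          · rw [abs_mul]
            refine mul_le_mul (abs_radialProfileDeriv₂_le he0 hA _) ?_ (abs_nonneg _)
              (by positivity)
            rw [abs_of_nonneg (sq_nonneg _)]
            nlinarith [sq_le_coordSq (a := a) hj z]
          · rw [abs_mul, abs_two]
            gcongr
            exact abs_radialProfileDeriv_le he0 hA hAB _
        · simpa [radialProfileDeriv₂_eq_zero h, radialProfileDeriv_eq_zero hAB h] using hpos
      · simpa using hpos
  have hprof : Continuous (radialProfile e A B) :=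
    continuous_iff_continuousAt.2 fun t => (hasDerivAt_radialProfile hA hAB t).continuousAt
  have hi₂ : ∀ j ∈ J, Integrable fun z => φ z * partialDeriv j (partialDeriv j w) z := by
    intro j hj
    obtain ⟨C, hC⟩ := (isCompact_Icc (a := (0 : ℝ)) (b := B)).exists_bound_of_continuousOn
      hprof.continuousOn
    have h0C : 0 ≤ C :=
      (norm_nonneg _).trans (hC 0 (left_mem_Icc.2 (hA.le.trans hAB)))
    refine (integrable_mul_of_bound (g := φ) (C := C) hK.measurableSet (hw₂K j hj) ?_ hφK
      (fun z => ?_)).congr (ae_of_all _ fun z => mul_comm _ _)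
    · exact Measurable.indicator (hprof.comp hsq).measurable hL
    · simp only [hφ, indicator]
      split_ifs with hzL
      · rcases le_or_gt (coordSq J a z) B with h | h
        · exact hC _ ⟨coordSq_nonneg z, h⟩
        · rwa [radialProfile_eq_zero hAB h.le, abs_zero]
      · rwa [abs_zero]
  have hparts : ∀ j ∈ J, ∫ z, w z * φ₂ j z =
      ∫ z, φ z * partialDeriv j (partialDeriv j w) z := by
    intro j hj
    refine integral_mul_eq_integral_mul_partialDeriv j hΩE hE hK hKΩ hw (φ₁ := φ₁ j)
      ?_ ?_ ?_ hφK (hφ₂K j) (hi₁ j hj) (hi₂ j hj)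
    · intro z
      refine indicator_hasLineDerivAt (f' := fun z =>
        radialProfileDeriv e A B (coordSq J a z) * (2 * (z j - a j))) (hLJ j hj) ?_
      have h1 := hasLineDerivAt_coordSq (a := a) hj z
      unfold HasLineDerivAt at h1 ⊢
      have h0 : HasDerivAt (radialProfile e A B) (radialProfileDeriv e A B (coordSq J a z))
          (coordSq J a (z + (0 : ℝ) • EuclideanSpace.single j 1)) := by
        simpa using hasDerivAt_radialProfile hA hAB (coordSq J a z)
      exact h0.comp (0 : ℝ) h1
    · intro z
      by_cases hz : z ∈ L
      · simp only [hφ₁, indicator, hLJ j hj, hz, if_true]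
        have : Continuous fun t : ℝ => z + t • EuclideanSpace.single j (1 : ℝ) := by fun_prop
        exact ((hD.comp hsq).comp this).mul (by fun_prop)
      · simp only [hφ₁, indicator, hLJ j hj, hz, if_false]
        exact continuous_const
    · intro z
      refine ((countable_coordSq_eq (a := a) hj z A).union
        (countable_coordSq_eq (a := a) hj z B)).mono fun t ht => ?_
      by_contra hcon
      simp only [mem_union, mem_ofPred_eq, not_or] at hcon
      apply ht
      set z' := z + t • EuclideanSpace.single j (1 : ℝ)
      refine indicator_hasLineDerivAt (f' := fun z =>
        radialProfileDeriv₂ e A B (coordSq J a z) * (2 * (z j - a j)) ^ 2 +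
          radialProfileDeriv e A B (coordSq J a z) * 2) (hLJ j hj) ?_
      have h1 := hasLineDerivAt_coordSq (a := a) hj z'
      unfold HasLineDerivAt at h1 ⊢
      have h2 : HasDerivAt (fun s : ℝ =>
          radialProfileDeriv e A B (coordSq J a (z' + s • EuclideanSpace.single j 1)))
          (radialProfileDeriv₂ e A B (coordSq J a z') * (2 * (z' j - a j))) 0 := by
        have h0 : HasDerivAt (radialProfileDeriv e A B)
            (radialProfileDeriv₂ e A B (coordSq J a z'))
            (coordSq J a (z' + (0 : ℝ) • EuclideanSpace.single j 1)) := by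
          simpa using hasDerivAt_radialProfileDeriv he0 hA hAB hcon.1 hcon.2
        exact h0.comp (0 : ℝ) h1
      have h3 : HasDerivAt (fun s : ℝ =>
          2 * ((z' + s • EuclideanSpace.single j (1 : ℝ)) j - a j)) 2 0 := by
        have : (fun s : ℝ => 2 * ((z' + s • EuclideanSpace.single j (1 : ℝ)) j - a j)) =
            fun s => 2 * (z' j + s - a j) := by
          ext s; simp
        rw [this]
        have := (((hasDerivAt_id (0 : ℝ)).const_add (z' j)).sub_const (a j)).const_mul 2
        simpa using this
      refine (h2.mul h3).congr_deriv ?_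
      simp
      ring
  have hmeas : ∀ C, MeasurableSet (L ∩ {z | coordSq J a z < C}) := fun C =>
    hL.inter (measurableSet_lt hsq.measurable measurable_const)
  have hwB : IntegrableOn w (L ∩ {z | coordSq J a z < B}) := hwK.mono_set hLK
  have hwA : IntegrableOn w (L ∩ {z | coordSq J a z < A}) :=
    hwB.mono_set fun z hz => ⟨hz.1, lt_of_lt_of_le hz.2 hAB⟩
  calc _ = ∫ z, ∑ j ∈ J, w z * φ₂ j z := by
        rw [← integral_indicator (hmeas B), ← integral_indicator (hmeas A),
          ← integral_const_mul, ← integral_const_mul, ← integral_sub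
          ((hwB.integrable_indicator (hmeas B)).const_mul _)
          ((hwA.integrable_indicator (hmeas A)).const_mul _)]
        congr 1 with z
        rw [← Finset.mul_sum]
        by_cases hz : z ∈ L
        -- Summing over `J` assembles the Laplacian of the profile; the term `2ψ'` is counted
        -- `J.card = 2 * e` times.
        · have h1 : ∑ j ∈ J, φ₂ j z =
              4 * coordSq J a z * radialProfileDeriv₂ e A B (coordSq J a z) +
                4 * e * radialProfileDeriv e A B (coordSq J a z) := by
            simp only [hφ₂, indicator_of_mem hz]
            rw [Finset.sum_add_distrib, ← Finset.mul_sum, Finset.sum_const, nsmul_eq_mul, ← he]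
            simp only [mul_pow, ← Finset.mul_sum]
            rw [← coordSq]
            ring
          rw [h1, radialProfile_laplacian he0 hA hAB]
          by_cases hzA : coordSq J a z < A
          · simp [indicator, hz, hzA, hzA.trans_le hAB]; ring
          · by_cases hzB : coordSq J a z < B
            · simp [indicator, hz, hzA, hzB]; ring
            · simp [indicator, hz, hzA, hzB]
        · simp [hφ₂, hz]
    _ = ∑ j ∈ J, ∫ z, w z * φ₂ j z := integral_finsetSum _ hi₁
    _ = ∑ j ∈ J, ∫ z, φ z * partialDeriv j (partialDeriv j w) z := Finset.sum_congr rfl hparts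
    _ = _ := by
        rw [← integral_finsetSum _ hi₂]
        congr 1 with z
        rw [Finset.mul_sum]

/-! ### Ball means, and the Laplacian of a `C²` subharmonic function. -/

theorem tendsto_setAverage_ball {F : Type*} [NormedAddCommGroup F] [NormedSpace ℝ F]
    [FiniteDimensional ℝ F] [MeasurableSpace F] [BorelSpace F] {μ : Measure F}
    [μ.IsAddHaarMeasure] {f : F → ℝ} {a : F} (hf : ContinuousAt f a) {R : ℝ} (hR : 0 < R)
    (hfR : IntegrableOn f (Metric.ball a R) μ) :
    Tendsto (fun r => ⨍ z in Metric.ball a r, f z ∂μ) (𝓝[>] 0) (𝓝 (f a)) := by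
  rw [Metric.tendsto_nhds]
  intro ε hε
  obtain ⟨δ, hδ, h⟩ := Metric.continuousAt_iff.1 hf (ε / 2) (by positivity)
  filter_upwards [Ioo_mem_nhdsGT (lt_min hδ hR)] with r hr
  have h1 : ⨍ z in Metric.ball a r, f z ∂μ ∈ Metric.closedBall (f a) (ε / 2) := by
    refine (convex_closedBall (f a) (ε / 2)).set_average_mem Metric.isClosed_closedBall
      (Metric.measure_ball_pos μ a hr.1).ne' measure_ball_lt_top.ne ?_
      (hfR.mono_set (Metric.ball_subset_ball (hr.2.le.trans (min_le_right _ _))))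
    filter_upwards [ae_restrict_mem Metric.isOpen_ball.measurableSet] with z hz
    exact (h ((Metric.mem_ball.1 hz).trans (hr.2.trans_le (min_le_left _ _)))).le
  exact (Metric.mem_closedBall.1 h1).trans_lt (by linarith)

theorem ballMean_coe {n : ℕ} {f : EuclideanSpace ℝ (Fin n) → ℝ} {a : EuclideanSpace ℝ (Fin n)}
    {r : ℝ} (hr : 0 < r) (hf : IntegrableOn f (Metric.ball a r)) :
    ballMean (fun z => (f z : EReal)) a r = ((⨍ z in Metric.ball a r, f z : ℝ) : EReal) := by
  have h0 : volume (Metric.ball a r) ≠ 0 := (Metric.measure_ball_pos volume a hr).ne'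
  have h1 : volume (Metric.ball a r) ≠ ⊤ := measure_ball_lt_top.ne
  have key : ∀ g : EuclideanSpace ℝ (Fin n) → ℝ, IntegrableOn g (Metric.ball a r) →
      (⨍⁻ z in Metric.ball a r, ENNReal.ofReal (g z) ∂volume) ≠ ⊤ := by
    intro g hg
    rw [setLAverage_eq]
    refine ENNReal.div_ne_top ?_ h0
    refine ne_top_of_le_ne_top hg.2.ne (lintegral_mono fun z => ?_)
    rw [← ofReal_norm]
    exact ENNReal.ofReal_le_ofReal (le_abs_self _)
  have hp := key f hf
  have hm := key (fun z => -f z) hf.neg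
  have e1 : ∀ z, ((f z : ℝ) : EReal).toENNReal = ENNReal.ofReal (f z) :=
    fun z => EReal.toENNReal_of_ne_top (EReal.coe_ne_top _)
  have e2 : ∀ z, (-((f z : ℝ) : EReal)).toENNReal = ENNReal.ofReal (-f z) := fun z => by
    rw [← EReal.coe_neg]; exact EReal.toENNReal_of_ne_top (EReal.coe_ne_top _)
  rw [ballMean]
  simp only [e1, e2]
  rw [← EReal.coe_ennreal_toReal hp, ← EReal.coe_ennreal_toReal hm,
    ← EReal.coe_sub]
  congr 1
  rw [setAverage_eq, integral_eq_lintegral_pos_part_sub_lintegral_neg_part hf, setLAverage_eq,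
    setLAverage_eq, ENNReal.toReal_div, ENNReal.toReal_div, smul_eq_mul, measureReal_def]
  ring

/-- With `A = r ^ 2` and `e = n / 2`, the weights in Green's identity become the `r ^ (-n)` of a
ball mean. -/
theorem rpow_neg_half_card {n : ℕ} {r : ℝ} (hr : 0 < r) :
    (r ^ 2) ^ (-((n : ℝ) / 2)) = (r ^ n)⁻¹ := by
  rw [Real.rpow_neg (by positivity), ← Real.rpow_natCast r 2, ← Real.rpow_mul hr.le,
    ← Real.rpow_natCast r n]
  congr 2
  push_cast; ring

theorem volume_real_ball {n : ℕ} (a : EuclideanSpace ℝ (Fin n)) {r : ℝ} (hr : 0 < r) :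
    volume.real (Metric.ball a r) =
      r ^ n * volume.real (Metric.ball (0 : EuclideanSpace ℝ (Fin n)) 1) := by
  rw [measureReal_def, measureReal_def, Measure.addHaar_ball_of_pos volume a hr, ENNReal.toReal_mul,
    ENNReal.toReal_ofReal (by positivity), finrank_euclideanSpace_fin]

theorem volume_real_ball_pos {n : ℕ} (a : EuclideanSpace ℝ (Fin n)) {r : ℝ} (hr : 0 < r) :
    0 < volume.real (Metric.ball a r) :=
  ENNReal.toReal_pos (Metric.measure_ball_pos volume a hr).ne' measure_ball_lt_top.ne

theorem coordSq_univ {n : ℕ} (a z : EuclideanSpace ℝ (Fin n)) :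
    coordSq Finset.univ a z = dist z a ^ 2 := by
  rw [coordSq, EuclideanSpace.dist_eq, Real.sq_sqrt (Finset.sum_nonneg fun _ _ => sq_nonneg _)]
  simp [Real.dist_eq]

theorem setOf_coordSq_univ_lt {n : ℕ} (a : EuclideanSpace ℝ (Fin n)) {r : ℝ} (hr : 0 < r) :
    {z | coordSq Finset.univ a z < r ^ 2} = Metric.ball a r := by
  ext z
  rw [mem_ofPred_eq, coordSq_univ, Metric.mem_ball, sq_lt_sq₀ dist_nonneg hr.le]

/-- The Laplacian of a subharmonic function of class `C²` is nonnegative. -/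
theorem SubharmonicOn.laplacian_nonneg {n : ℕ} (hn : 0 < n) {U : Set (EuclideanSpace ℝ (Fin n))}
    (hU : IsOpen U) {f : EuclideanSpace ℝ (Fin n) → ℝ} (hf : ContDiffOn ℝ 2 f U)
    (hsub : SubharmonicOn (fun z => (f z : EReal)) U) {a : EuclideanSpace ℝ (Fin n)}
    (ha : a ∈ U) : 0 ≤ ∑ i, partialDeriv i (partialDeriv i f) a := by
  have : Nonempty (Fin n) := ⟨⟨0, hn⟩⟩
  by_contra! hneg
  have hcont : ContinuousOn (fun z => ∑ i, partialDeriv i (partialDeriv i f) z) U :=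
    continuousOn_finsetSum _ fun i _ => continuousOn_partialDeriv_partialDeriv hU hf i
  obtain ⟨R, hR, hRU⟩ := Metric.nhds_basis_closedBall.mem_iff.1
    (Filter.inter_mem (hU.mem_nhds ha)
      ((hcont.continuousAt (hU.mem_nhds ha)).preimage_mem_nhds (Iio_mem_nhds hneg)))
  have hKU : Metric.closedBall a R ⊆ U := fun z hz => (hRU hz).1
  have hK : IsCompact (Metric.closedBall a R) := isCompact_closedBall a R
  have hfK : IntegrableOn f (Metric.closedBall a R) :=
    (hf.continuousOn.mono hKU).integrableOn_compact hK
  -- If the Laplacian is negative on the closed ball of radius `R`, Green's identity with `E = ∅`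
  -- and no cutoff makes the means strictly decreasing in the radius.
  have hstrict : ∀ r₁ r₂, 0 < r₁ → r₁ < r₂ → r₂ ≤ R →
      ⨍ z in Metric.ball a r₂, f z < ⨍ z in Metric.ball a r₁, f z := by
    intro r₁ r₂ h1 h12 h2R
    have h2 := h1.trans h12
    have he : (0 : ℝ) < (n : ℝ) / 2 := by positivity
    have hAB : r₁ ^ 2 < r₂ ^ 2 := by gcongr
    have hA : 0 < r₁ ^ 2 := by positivity
    have hG := integral_sub_integral_eq_integral_radialProfile (J := Finset.univ)
      Finset.univ_nonempty (a := a) (Ω := U) (E := ∅) (K := Metric.closedBall a R) (L := univ)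
      (by simpa using hU) (by simp) hK hKU MeasurableSet.univ (by simp)
      (e := (n : ℝ) / 2) (A := r₁ ^ 2) (B := r₂ ^ 2) (by simp; ring) hA hAB.le
      (by
        rw [setOf_coordSq_univ_lt a h2, univ_inter]
        exact (Metric.ball_subset_ball h2R).trans Metric.ball_subset_closedBall)
      (by simpa using hf) hfK
      (fun j _ => ((continuousOn_partialDeriv_partialDeriv hU hf j).mono hKU).integrableOn_compact
        hK)
    rw [setOf_coordSq_univ_lt a h2, setOf_coordSq_univ_lt a h1, univ_inter, univ_inter,
      rpow_neg_half_card h1, rpow_neg_half_card h2] at hG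
    simp only [indicator_univ] at hG
    set φ : EuclideanSpace ℝ (Fin n) → ℝ := fun z =>
      radialProfile ((n : ℝ) / 2) (r₁ ^ 2) (r₂ ^ 2) (coordSq Finset.univ a z) with hφ
    set G : EuclideanSpace ℝ (Fin n) → ℝ := fun z =>
      φ z * -∑ i, partialDeriv i (partialDeriv i f) z with hGdef
    have hφ0 : ∀ z ∉ Metric.closedBall a R, φ z = 0 := fun z hz => by
      rw [hφ]
      refine radialProfile_eq_zero hAB.le ?_
      rw [coordSq_univ]
      rw [Metric.mem_closedBall, not_le] at hz
      gcongr
      exact h2R.trans hz.le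
    have hφc : Continuous φ :=
      (continuous_iff_continuousAt.2 fun t =>
        (hasDerivAt_radialProfile hA hAB.le t).continuousAt).comp continuous_coordSq
    have hGi : Integrable G := by
      rw [← integrableOn_iff_integrable_of_support_subset (s := Metric.closedBall a R)]
      · exact (hφc.continuousOn.mul (hcont.mono hKU).neg).integrableOn_compact hK
      · intro z hz
        by_contra hzK
        exact hz (by simp [hGdef, hφ0 z hzK])
    have hGpos : 0 < ∫ z, G z := by
      rw [integral_pos_iff_support_of_nonneg _ hGi]
      · refine (Metric.measure_ball_pos volume a h2).trans_le (measure_mono fun z hz => ?_)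
        rw [Metric.mem_ball] at hz
        refine (mul_pos (radialProfile_pos he hA hAB ?_) ?_).ne'
        · rw [coordSq_univ]; gcongr
        · exact neg_pos.2 (hRU (Metric.mem_closedBall.2 (hz.le.trans h2R))).2
      · intro z
        by_cases hz : z ∈ Metric.closedBall a R
        · exact mul_nonneg (radialProfile_nonneg he hA hAB.le _) (neg_nonneg.2 (hRU hz).2.le)
        · simp [hGdef, hφ0 z hz]
    have hGneg : ∫ z, G z = -∫ z, φ z * ∑ i, partialDeriv i (partialDeriv i f) z := by
      rw [← integral_neg]; simp [hGdef]
    have hc := volume_real_ball_pos (0 : EuclideanSpace ℝ (Fin n)) one_pos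
    rw [setAverage_eq, setAverage_eq, volume_real_ball a h1, volume_real_ball a h2, mul_inv,
      mul_inv, smul_eq_mul, smul_eq_mul, mul_right_comm, mul_right_comm (r₁ ^ n)⁻¹]
    refine mul_lt_mul_of_pos_right ?_ (inv_pos.2 hc)
    linarith
  have hlim := tendsto_setAverage_ball (μ := volume)
    (hf.continuousOn.continuousAt (hU.mem_nhds ha)) hR
    (hfK.mono_set Metric.ball_subset_closedBall)
  -- Contradiction: the value at `a` is at most the mean over radius `R`, which is below the mean
  -- over `R / 2`, which is at most the limit `f a` of the means over small balls.
  have h1 : f a ≤ ⨍ z in Metric.ball a R, f z := by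
    have := hsub.le_ballMean a R hR hKU
    rw [ballMean_coe hR (hfK.mono_set Metric.ball_subset_closedBall)] at this
    exact_mod_cast this
  have h2 := hstrict (R / 2) R (by positivity) (by linarith) le_rfl
  have h3 : ⨍ z in Metric.ball a (R / 2), f z ≤ f a := by
    refine ge_of_tendsto hlim ?_
    filter_upwards [Ioo_mem_nhdsGT (half_pos hR)] with r hr
    exact (hstrict r (R / 2) hr.1 hr.2 (by linarith)).le
  linarith

/-- Vanishing of `ℋ^(n-1)` forces that of `ℋ^n`, which in the sup metric is Lebesgue measure. -/
theorem volume_eq_zero_of_hausdorffMeasure {n : ℕ} {E : Set (EuclideanSpace ℝ (Fin n))}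
    (hE : Measure.hausdorffMeasure ((n : ℝ) - 1) E = 0) : volume E = 0 := by
  have h1 : Measure.hausdorffMeasure (n : ℝ) E = 0 :=
    le_antisymm ((Measure.hausdorffMeasure_mono (by linarith) E).trans hE.le) zero_le
  have h2 := (PiLp.lipschitzWith_ofLp 2 (fun _ : Fin n => ℝ)).hausdorffMeasure_image_le
    (Nat.cast_nonneg n) E
  have h4 : (Measure.hausdorffMeasure (n : ℝ) : Measure (Fin n → ℝ)) = volume := by
    rw [← hausdorffMeasure_pi_real, Fintype.card_fin]
  rw [h1, mul_zero, nonpos_iff_eq_zero, h4] at h2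
  have h3 := (PiLp.volume_preserving_ofLp (Fin n)).measure_preimage_emb
    (MeasurableEquiv.toLp 2 (Fin n → ℝ)).symm.measurableEmbedding (WithLp.ofLp '' E)
  exact measure_mono_null (subset_preimage_image _ E) (h3.trans h2)

/-- Monotonicity in the radius of the normalised integral of `w` over balls in the coordinates of
`J`, when the Laplacian of `w` in these coordinates is nonnegative off a small closed set. -/
theorem inv_pow_mul_setIntegral_mono {n : ℕ} {J : Finset (Fin n)}
    (hJ : J.Nonempty) {a : EuclideanSpace ℝ (Fin n)} {Ω E K L : Set (EuclideanSpace ℝ (Fin n))}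
    (hΩE : IsOpen (Ω \ E)) (hE : Measure.hausdorffMeasure ((n : ℝ) - 1) E = 0)
    (hK : IsCompact K) (hKΩ : K ⊆ Ω) (hL : MeasurableSet L)
    (hLJ : ∀ j ∈ J, ∀ z (t : ℝ), z + t • EuclideanSpace.single j 1 ∈ L ↔ z ∈ L)
    {r₁ r₂ : ℝ} (hr₁ : 0 < r₁) (hr : r₁ ≤ r₂)
    (hLK : L ∩ {z | coordSq J a z < r₂ ^ 2} ⊆ K)
    {w : EuclideanSpace ℝ (Fin n) → ℝ} (hw : ContDiffOn ℝ 2 w (Ω \ E)) (hwK : IntegrableOn w K)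
    (hw₂K : ∀ j ∈ J, IntegrableOn (partialDeriv j (partialDeriv j w)) K)
    (hΔ : ∀ z ∈ Ω \ E, 0 ≤ ∑ j ∈ J, partialDeriv j (partialDeriv j w) z) :
    (r₁ ^ J.card)⁻¹ * (∫ z in L ∩ {z | coordSq J a z < r₁ ^ 2}, w z) ≤
      (r₂ ^ J.card)⁻¹ * (∫ z in L ∩ {z | coordSq J a z < r₂ ^ 2}, w z) := by
  have hr₂ := hr₁.trans_le hr
  have hA : 0 < r₁ ^ 2 := by positivity
  have hAB : r₁ ^ 2 ≤ r₂ ^ 2 := by gcongr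
  have he : 0 < (J.card : ℝ) / 2 := by
    have : (0 : ℝ) < J.card := by exact_mod_cast hJ.card_pos
    positivity
  have hG := integral_sub_integral_eq_integral_radialProfile hJ hΩE hE hK hKΩ hL hLJ
    (e := (J.card : ℝ) / 2) (by ring) hA hAB hLK hw hwK hw₂K
  rw [rpow_neg_half_card hr₁, rpow_neg_half_card hr₂] at hG
  rw [← sub_nonneg, hG]
  refine integral_nonneg_of_ae ?_
  filter_upwards [measure_eq_zero_iff_ae_notMem.1 (volume_eq_zero_of_hausdorffMeasure hE)]
    with z hzE
  simp only [indicator, Pi.zero_apply]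
  split_ifs with hzL
  · rcases lt_or_ge (coordSq J a z) (r₂ ^ 2) with h | h
    · exact mul_nonneg (radialProfile_nonneg he hA hAB _) (hΔ z ⟨hKΩ (hLK ⟨hzL, h⟩), hzE⟩)
    · rw [radialProfile_eq_zero hAB h, zero_mul]
  · rw [zero_mul]

/-! ### The splitting `ℝ^(p+q) = ℝ^p × ℝ^q` and monotonicity of product means. -/

section join

variable {p q : ℕ}

@[simp] theorem join_castAdd (x : EuclideanSpace ℝ (Fin p)) (y : EuclideanSpace ℝ (Fin q))
    (i : Fin p) : join x y (Fin.castAdd q i) = x i := by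
  simp [join]

@[simp] theorem join_natAdd (x : EuclideanSpace ℝ (Fin p)) (y : EuclideanSpace ℝ (Fin q))
    (j : Fin q) : join x y (Fin.natAdd p j) = y j := by
  simp [join]

theorem join_add_smul_left (x : EuclideanSpace ℝ (Fin p)) (y : EuclideanSpace ℝ (Fin q))
    (i : Fin p) (t : ℝ) : join (x + t • EuclideanSpace.single i 1) y =
      join x y + t • EuclideanSpace.single (Fin.castAdd q i) 1 := by
  ext k
  refine Fin.addCases (fun k => ?_) (fun k => ?_) k
  · by_cases h : k = i
    · simp [h]
    · simp [h]
  · simp [Fin.ext_iff]; lia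

theorem join_add_smul_right (x : EuclideanSpace ℝ (Fin p)) (y : EuclideanSpace ℝ (Fin q))
    (j : Fin q) (t : ℝ) : join x (y + t • EuclideanSpace.single j 1) =
      join x y + t • EuclideanSpace.single (Fin.natAdd p j) 1 := by
  ext k
  refine Fin.addCases (fun k => ?_) (fun k => ?_) k
  · simp [Fin.ext_iff]; lia
  · by_cases h : k = j
    · simp [h]
    · simp [h]

/-- `join` as a homeomorphism `ℝ^p × ℝ^q ≃ ℝ^(p+q)`. -/
noncomputable def joinHomeomorph (p q : ℕ) :
    EuclideanSpace ℝ (Fin p) × EuclideanSpace ℝ (Fin q) ≃ₜ EuclideanSpace ℝ (Fin (p + q)) where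
  toFun z := join z.1 z.2
  invFun z := (WithLp.toLp 2 fun i => z (Fin.castAdd q i), WithLp.toLp 2 fun j => z (Fin.natAdd p j))
  left_inv z := by ext k <;> simp
  right_inv z := by
    ext k
    refine Fin.addCases (fun k => ?_) (fun k => ?_) k <;> simp
  continuous_toFun := by
    refine (PiLp.continuous_toLp 2 _).comp (continuous_pi fun k => ?_)
    refine Fin.addCases (fun k => ?_) (fun k => ?_) k
    · simp only [Fin.append_left]; fun_prop
    · simp only [Fin.append_right]; fun_prop
  continuous_invFun := by
    refine Continuous.prodMk ?_ ?_ <;>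
    exact (PiLp.continuous_toLp 2 _).comp (continuous_pi fun k => by fun_prop)

@[simp] theorem joinHomeomorph_apply (z : EuclideanSpace ℝ (Fin p) × EuclideanSpace ℝ (Fin q)) :
    joinHomeomorph p q z = join z.1 z.2 := rfl

theorem volume_preserving_join :
    MeasurePreserving (joinHomeomorph p q) := by
  have h1 := (PiLp.volume_preserving_ofLp (Fin p)).prod (PiLp.volume_preserving_ofLp (Fin q))
  have h2 := (volume_measurePreserving_sumPiEquivProdPi (fun _ : Fin p ⊕ Fin q => ℝ)).symm
  have h3 := volume_measurePreserving_piCongrLeft (fun _ : Fin (p + q) => ℝ) finSumFinEquiv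
  have h4 := PiLp.volume_preserving_toLp (Fin (p + q))
  refine (congrArg (fun f => MeasurePreserving f volume volume) ?_).mp
    (h4.comp (h3.comp (h2.comp h1)))
  ext z k
  refine Fin.addCases (fun k => ?_) (fun k => ?_) k
  · have := MeasurableEquiv.piCongrLeft_apply_apply (β := fun _ : Fin (p + q) => ℝ) finSumFinEquiv
      ((MeasurableEquiv.sumPiEquivProdPi (fun _ : Fin p ⊕ Fin q => ℝ)).symm
        (z.1.ofLp, z.2.ofLp)) (Sum.inl k)
    exact this.trans (join_castAdd z.1 z.2 k).symm
  · have := MeasurableEquiv.piCongrLeft_apply_apply (β := fun _ : Fin (p + q) => ℝ) finSumFinEquiv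
      ((MeasurableEquiv.sumPiEquivProdPi (fun _ : Fin p ⊕ Fin q => ℝ)).symm
        (z.1.ofLp, z.2.ofLp)) (Sum.inr k)
    exact this.trans (join_natAdd z.1 z.2 k).symm

theorem setIntegral_preimage_join (w : EuclideanSpace ℝ (Fin (p + q)) → ℝ)
    (T : Set (EuclideanSpace ℝ (Fin (p + q)))) :
    ∫ z in joinHomeomorph p q ⁻¹' T, w (join z.1 z.2) = ∫ z in T, w z :=
  volume_preserving_join.setIntegral_preimage_emb
    (joinHomeomorph p q).measurableEmbedding w T

theorem locallyIntegrableOn_comp_join {w : EuclideanSpace ℝ (Fin (p + q)) → ℝ}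
    {Ω : Set (EuclideanSpace ℝ (Fin (p + q)))} (hw : LocallyIntegrableOn w Ω) :
    LocallyIntegrableOn
      (fun z : EuclideanSpace ℝ (Fin p) × EuclideanSpace ℝ (Fin q) => w (join z.1 z.2))
      (joinHomeomorph p q ⁻¹' Ω) := by
  intro z hz
  obtain ⟨t, ht, hti⟩ := hw _ hz
  refine ⟨joinHomeomorph p q ⁻¹' t, ?_, ?_⟩
  · exact (joinHomeomorph p q).continuous.continuousWithinAt.tendsto_nhdsWithin
      (mapsTo_preimage _ _) ht
  · exact (volume_preserving_join.integrableOn_comp_preimage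
      (joinHomeomorph p q).measurableEmbedding).2 hti

theorem partialDeriv_comp_join_left (w : EuclideanSpace ℝ (Fin (p + q)) → ℝ)
    (x : EuclideanSpace ℝ (Fin p)) (y : EuclideanSpace ℝ (Fin q)) (i : Fin p) :
    partialDeriv i (fun x => w (join x y)) x = partialDeriv (Fin.castAdd q i) w (join x y) := by
  simp only [partialDeriv, lineDeriv, join_add_smul_left]

theorem partialDeriv_comp_join_right (w : EuclideanSpace ℝ (Fin (p + q)) → ℝ)
    (x : EuclideanSpace ℝ (Fin p)) (y : EuclideanSpace ℝ (Fin q)) (j : Fin q) :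
    partialDeriv j (fun y => w (join x y)) y = partialDeriv (Fin.natAdd p j) w (join x y) := by
  simp only [partialDeriv, lineDeriv, join_add_smul_right]

theorem contDiff_join : ContDiff ℝ 2
    (fun z : EuclideanSpace ℝ (Fin p) × EuclideanSpace ℝ (Fin q) => join z.1 z.2) := by
  rw [contDiff_euclidean]
  intro k
  refine Fin.addCases (fun k => ?_) (fun k => ?_) k
  · simp only [join_castAdd]; fun_prop
  · simp only [join_natAdd]; fun_prop

theorem coordSq_join_left (x x₀ : EuclideanSpace ℝ (Fin p)) (y y₀ : EuclideanSpace ℝ (Fin q)) :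
    coordSq (Finset.univ.map (Fin.castAddEmb q)) (join x₀ y₀) (join x y) = dist x x₀ ^ 2 := by
  rw [← coordSq_univ, coordSq, coordSq, Finset.sum_map]
  simp

theorem coordSq_join_right (x x₀ : EuclideanSpace ℝ (Fin p)) (y y₀ : EuclideanSpace ℝ (Fin q)) :
    coordSq (Finset.univ.map (Fin.natAddEmb p)) (join x₀ y₀) (join x y) = dist y y₀ ^ 2 := by
  rw [← coordSq_univ, coordSq, coordSq, Finset.sum_map]
  simp

theorem setAverage_ball_prod_ball (u : EuclideanSpace ℝ (Fin p) × EuclideanSpace ℝ (Fin q) → ℝ)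
    (x : EuclideanSpace ℝ (Fin p)) (y : EuclideanSpace ℝ (Fin q)) {r s : ℝ} (hr : 0 < r)
    (hs : 0 < s) :
    ⨍ z in Metric.ball x r ×ˢ Metric.ball y s, u z =
      ((r ^ p)⁻¹ * ∫ z in Metric.ball x r ×ˢ Metric.ball y s, u z) * ((s ^ q)⁻¹ *
        (volume.real (Metric.ball (0 : EuclideanSpace ℝ (Fin p)) 1))⁻¹ *
        (volume.real (Metric.ball (0 : EuclideanSpace ℝ (Fin q)) 1))⁻¹) := by
  rw [setAverage_eq, Measure.volume_eq_prod, measureReal_prod_prod, volume_real_ball x hr,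
    volume_real_ball y hs, smul_eq_mul]
  simp only [mul_inv]
  ring

variable {Ω E : Set (EuclideanSpace ℝ (Fin (p + q)))} {w : EuclideanSpace ℝ (Fin (p + q)) → ℝ}
  {x₀ : EuclideanSpace ℝ (Fin p)} {y₀ : EuclideanSpace ℝ (Fin q)} {r₁ r₂ s : ℝ}

/-- Averages of `w` over products of balls increase with the radius of the first factor. -/
theorem setAverage_join_mono_left (hp : 0 < p) (hΩE : IsOpen (Ω \ E))
    (hE : Measure.hausdorffMeasure ((p : ℝ) + (q : ℝ) - 1) E = 0)
    (hw_sub : SeparatelySubharmonicOn p q (fun z => (w z : EReal)) (Ω \ E))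
    (hw_loc : LocallyIntegrableOn w Ω volume) (hw : ContDiffOn ℝ 2 w (Ω \ E))
    (hw_dd : ∀ i, LocallyIntegrableOn (partialDeriv i (partialDeriv i w)) Ω volume)
    (hr₁ : 0 < r₁) (hr : r₁ ≤ r₂) (hs : 0 < s)
    (hΩ : Metric.closedBall x₀ r₂ ×ˢ Metric.closedBall y₀ s ⊆ joinHomeomorph p q ⁻¹' Ω) :
    ⨍ z in Metric.ball x₀ r₁ ×ˢ Metric.ball y₀ s, w (join z.1 z.2) ≤
      ⨍ z in Metric.ball x₀ r₂ ×ˢ Metric.ball y₀ s, w (join z.1 z.2) := by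
  have hr₂ := hr₁.trans_le hr
  have hK := ((isCompact_closedBall x₀ r₂).prod (isCompact_closedBall y₀ s)).image
    (joinHomeomorph p q).continuous
  have hKΩ := image_subset_iff.2 hΩ
  have : Nonempty (Fin p) := ⟨⟨0, hp⟩⟩
  -- The cylinder over the ball in `y` is invariant under translation in `x`; its intersection with
  -- a ball condition in `x` is the product of balls.
  set L : Set (EuclideanSpace ℝ (Fin (p + q))) :=
    joinHomeomorph p q '' (univ ×ˢ Metric.ball y₀ s) with hLdef
  have hset : ∀ r, 0 < r → joinHomeomorph p q ⁻¹' (L ∩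
      {z | coordSq (Finset.univ.map (Fin.castAddEmb q)) (join x₀ y₀) z < r ^ 2}) =
      Metric.ball x₀ r ×ˢ Metric.ball y₀ s := by
    intro r hr
    rw [preimage_inter, hLdef, preimage_image_eq _ (joinHomeomorph p q).injective]
    ext z
    simp only [mem_inter_iff, mem_prod, mem_univ, true_and, mem_preimage, mem_ofPred_eq,
      joinHomeomorph_apply, coordSq_join_left, Metric.mem_ball,
      sq_lt_sq₀ dist_nonneg hr.le]
    tauto
  have hm := inv_pow_mul_setIntegral_mono (J := Finset.univ.map (Fin.castAddEmb q))
    (by simp) (a := join x₀ y₀) (Ω := Ω) (E := E) (L := L) (w := w) hΩE (by push_cast; exact hE) hK hKΩ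
    ((joinHomeomorph p q).isOpenMap _ (isOpen_univ.prod Metric.isOpen_ball)).measurableSet
    ?_ hr₁ hr ?_ hw (hw_loc.mono_set hKΩ |>.integrableOn_isCompact hK)
    (fun j _ => (hw_dd j).mono_set hKΩ |>.integrableOn_isCompact hK) ?_
  · rw [Finset.card_map, Finset.card_univ, Fintype.card_fin, ← setIntegral_preimage_join,
      ← setIntegral_preimage_join, hset r₁ hr₁, hset r₂ hr₂] at hm
    rw [setAverage_ball_prod_ball _ x₀ y₀ hr₁ hs, setAverage_ball_prod_ball _ x₀ y₀ hr₂ hs]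
    exact mul_le_mul_of_nonneg_right hm (by positivity)
  · intro j hj z t
    obtain ⟨i, -, rfl⟩ := Finset.mem_map.1 hj
    obtain ⟨⟨x, y⟩, rfl⟩ := (joinHomeomorph p q).surjective z
    have h1 : joinHomeomorph p q (x, y) + t • EuclideanSpace.single (Fin.castAddEmb q i) 1 =
        joinHomeomorph p q (x + t • EuclideanSpace.single i 1, y) :=
      (join_add_smul_left x y i t).symm
    rw [h1, hLdef, (joinHomeomorph p q).injective.mem_set_image,
      (joinHomeomorph p q).injective.mem_set_image]
    simp
  · rw [← (joinHomeomorph p q).image_preimage (L ∩ _), hset r₂ hr₂]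
    exact image_mono (prod_mono Metric.ball_subset_closedBall Metric.ball_subset_closedBall)
  · intro z hz
    obtain ⟨⟨x, y⟩, rfl⟩ := (joinHomeomorph p q).surjective z
    have hcont : ContDiff ℝ 2 fun x : EuclideanSpace ℝ (Fin p) => join x y :=
      contDiff_join.comp (contDiff_id.prodMk contDiff_const)
    -- Separate subharmonicity enters here: each slice is `C²` and subharmonic on an open set, so
    -- the partial Laplacian is nonnegative off `E`.
    have := (hw_sub.1 y).laplacian_nonneg hp (hΩE.preimage hcont.continuous)
      (hw.comp hcont.contDiffOn fun _ h => h) (a := x) hz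
    rw [Finset.sum_map]
    refine this.trans_eq (Finset.sum_congr rfl fun i _ => ?_)
    have h1 : partialDeriv i (w ∘ fun x => join x y) = fun x =>
        partialDeriv (Fin.castAdd q i) w (join x y) :=
      funext fun x => partialDeriv_comp_join_left w x y i
    rw [h1, partialDeriv_comp_join_left]
    rfl

/-- Averages of `w` over products of balls increase with the radius of the second factor. -/
theorem setAverage_join_mono_right (hq : 0 < q) (hΩE : IsOpen (Ω \ E))
    (hE : Measure.hausdorffMeasure ((p : ℝ) + (q : ℝ) - 1) E = 0)
    (hw_sub : SeparatelySubharmonicOn p q (fun z => (w z : EReal)) (Ω \ E))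
    (hw_loc : LocallyIntegrableOn w Ω volume) (hw : ContDiffOn ℝ 2 w (Ω \ E))
    (hw_dd : ∀ i, LocallyIntegrableOn (partialDeriv i (partialDeriv i w)) Ω volume)
    (hr₁ : 0 < r₁) (hr : r₁ ≤ r₂) (hs : 0 < s)
    (hΩ : Metric.closedBall x₀ s ×ˢ Metric.closedBall y₀ r₂ ⊆ joinHomeomorph p q ⁻¹' Ω) :
    ⨍ z in Metric.ball x₀ s ×ˢ Metric.ball y₀ r₁, w (join z.1 z.2) ≤
      ⨍ z in Metric.ball x₀ s ×ˢ Metric.ball y₀ r₂, w (join z.1 z.2) := by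
  have hr₂ := hr₁.trans_le hr
  have hK := ((isCompact_closedBall x₀ s).prod (isCompact_closedBall y₀ r₂)).image
    (joinHomeomorph p q).continuous
  have hKΩ := image_subset_iff.2 hΩ
  have : Nonempty (Fin q) := ⟨⟨0, hq⟩⟩
  set L : Set (EuclideanSpace ℝ (Fin (p + q))) :=
    joinHomeomorph p q '' (Metric.ball x₀ s ×ˢ univ) with hLdef
  have hset : ∀ r, 0 < r → joinHomeomorph p q ⁻¹' (L ∩
      {z | coordSq (Finset.univ.map (Fin.natAddEmb p)) (join x₀ y₀) z < r ^ 2}) =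
      Metric.ball x₀ s ×ˢ Metric.ball y₀ r := by
    intro r hr
    rw [preimage_inter, hLdef, preimage_image_eq _ (joinHomeomorph p q).injective]
    ext z
    simp only [mem_inter_iff, mem_prod, mem_univ, and_true, mem_preimage, mem_ofPred_eq,
      joinHomeomorph_apply, coordSq_join_right, Metric.mem_ball,
      sq_lt_sq₀ dist_nonneg hr.le]
  have hm := inv_pow_mul_setIntegral_mono (J := Finset.univ.map (Fin.natAddEmb p))
    (by simp) (a := join x₀ y₀) (Ω := Ω) (E := E) (L := L) (w := w) hΩE (by push_cast; exact hE) hK hKΩ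
    ((joinHomeomorph p q).isOpenMap _ (Metric.isOpen_ball.prod isOpen_univ)).measurableSet
    ?_ hr₁ hr ?_ hw (hw_loc.mono_set hKΩ |>.integrableOn_isCompact hK)
    (fun j _ => (hw_dd j).mono_set hKΩ |>.integrableOn_isCompact hK) ?_
  · rw [Finset.card_map, Finset.card_univ, Fintype.card_fin, ← setIntegral_preimage_join,
      ← setIntegral_preimage_join, hset r₁ hr₁, hset r₂ hr₂] at hm
    rw [setAverage_ball_prod_ball _ x₀ y₀ hs hr₁, setAverage_ball_prod_ball _ x₀ y₀ hs hr₂]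
    have := mul_le_mul_of_nonneg_right hm (a := (s ^ p)⁻¹ *
      (volume.real (Metric.ball (0 : EuclideanSpace ℝ (Fin p)) 1))⁻¹ *
      (volume.real (Metric.ball (0 : EuclideanSpace ℝ (Fin q)) 1))⁻¹) (by positivity)
    linarith
  · intro j hj z t
    obtain ⟨i, -, rfl⟩ := Finset.mem_map.1 hj
    obtain ⟨⟨x, y⟩, rfl⟩ := (joinHomeomorph p q).surjective z
    have h1 : joinHomeomorph p q (x, y) + t • EuclideanSpace.single (Fin.natAddEmb p i) 1 =
        joinHomeomorph p q (x, y + t • EuclideanSpace.single i 1) :=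
      (join_add_smul_right x y i t).symm
    rw [h1, hLdef, (joinHomeomorph p q).injective.mem_set_image,
      (joinHomeomorph p q).injective.mem_set_image]
    simp
  · rw [← (joinHomeomorph p q).image_preimage (L ∩ _), hset r₂ hr₂]
    exact image_mono (prod_mono Metric.ball_subset_closedBall Metric.ball_subset_closedBall)
  · intro z hz
    obtain ⟨⟨x, y⟩, rfl⟩ := (joinHomeomorph p q).surjective z
    have hcont : ContDiff ℝ 2 fun y : EuclideanSpace ℝ (Fin q) => join x y :=
      contDiff_join.comp (contDiff_const.prodMk contDiff_id)
    have := (hw_sub.2 x).laplacian_nonneg hq (hΩE.preimage hcont.continuous)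
      (hw.comp hcont.contDiffOn fun _ h => h) (a := y) hz
    rw [Finset.sum_map]
    refine this.trans_eq (Finset.sum_congr rfl fun i _ => ?_)
    have h1 : partialDeriv i (w ∘ fun y => join x y) = fun y =>
        partialDeriv (Fin.natAdd p i) w (join x y) :=
      funext fun y => partialDeriv_comp_join_right w x y i
    rw [h1, partialDeriv_comp_join_right]
    rfl

end join

/-! ### Iterated ball means. -/

section ballAverage

variable {F : Type*} [NormedAddCommGroup F] [NormedSpace ℝ F] [FiniteDimensional ℝ F]
  [MeasurableSpace F] [BorelSpace F] {μ : Measure F} [μ.IsAddHaarMeasure]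

theorem setAverage_ball_eq (f : F → ℝ) (x : F) (r : ℝ) :
    ⨍ z in Metric.ball x r, f z ∂μ =
      (μ.real (Metric.ball 0 r))⁻¹ * ∫ z in Metric.ball x r, f z ∂μ := by
  rw [setAverage_eq, measureReal_def, Measure.addHaar_ball_center, ← measureReal_def, smul_eq_mul]

theorem continuousAt_setAverage_ball {f : F → ℝ} {a : F} {r R : ℝ} (hr : 0 < r) (hrR : r < R)
    (hf : IntegrableOn f (Metric.ball a R) μ) :
    ContinuousAt (fun x => ⨍ z in Metric.ball x r, f z ∂μ) a := by
  simp only [setAverage_ball_eq]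
  refine continuousAt_const.mul ?_
  simp only [← integral_indicator (Metric.isOpen_ball (x := _) (ε := r)).measurableSet]
  have hnear : ∀ᶠ x in 𝓝 a, Metric.ball x r ⊆ Metric.ball a R := by
    filter_upwards [Metric.ball_mem_nhds a (sub_pos.2 hrR)] with x hx
    refine Metric.ball_subset_ball' ?_
    rw [Metric.mem_ball] at hx
    linarith
  refine continuousAt_of_dominated (bound := (Metric.ball a R).indicator fun z => ‖f z‖)
    ?_ ?_ (IntegrableOn.integrable_indicator hf.norm Metric.isOpen_ball.measurableSet) ?_
  · filter_upwards [hnear] with x hx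
    exact ((hf.mono_set hx).integrable_indicator
      Metric.isOpen_ball.measurableSet).aestronglyMeasurable
  · filter_upwards [hnear] with x hx
    refine ae_of_all _ fun z => ?_
    rw [norm_indicator_eq_indicator_norm]
    exact indicator_le_indicator_of_subset hx (fun _ => norm_nonneg _) z
  -- For `z` off the null sphere around `a`, membership of `z` in `Metric.ball x r` does not change
  -- for `x` near `a`.
  · filter_upwards [measure_eq_zero_iff_ae_notMem.1
      (Measure.addHaar_sphere_of_ne_zero μ a hr.ne')] with z hz
    rw [Metric.mem_sphere] at hz
    have hd : Continuous fun x => dist z x := by fun_prop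
    rcases lt_or_gt_of_ne hz with h | h
    · refine continuousAt_const.congr (f := fun _ => f z) ?_
      filter_upwards [hd.continuousAt.eventually_lt_const h] with x hx
      rw [indicator_of_mem (Metric.mem_ball.2 hx)]
    · refine continuousAt_const.congr (f := fun _ => (0 : ℝ)) ?_
      filter_upwards [hd.continuousAt.eventually_const_lt h] with x hx
      rw [indicator_of_notMem (fun h => absurd (Metric.mem_ball.1 h) (not_lt.2 hx.le))]

/-- The reflection `x ↦ a + z - x` preserves `μ` and exchanges the two centres. -/
theorem measure_ball_inter_ball_comm (a z : F) (r s : ℝ) :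
    μ (Metric.ball a s ∩ Metric.ball z r) = μ (Metric.ball a r ∩ Metric.ball z s) := by
  have h := (Measure.measurePreserving_sub_left μ (a + z)).measure_preimage
    (s := Metric.ball a r ∩ Metric.ball z s)
    (Metric.isOpen_ball.inter Metric.isOpen_ball).measurableSet.nullMeasurableSet
  rw [← h]
  congr 1
  ext x
  simp only [mem_inter_iff, Metric.mem_ball, mem_preimage, dist_eq_norm]
  rw [show a + z - x - a = -(x - z) by abel, show a + z - x - z = -(x - a) by abel, norm_neg,
    norm_neg, and_comm]

theorem integral_ball_integral_ball {g : F → ℝ} (hg : Integrable g μ) (a : F) (r s : ℝ) :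
    ∫ x in Metric.ball a s, ∫ z in Metric.ball x r, g z ∂μ ∂μ =
      ∫ z, g z * μ.real (Metric.ball a s ∩ Metric.ball z r) ∂μ := by
  set S : Set (F × F) := {q | q.1 ∈ Metric.ball a s ∧ dist q.2 q.1 < r} with hS
  have hSm : MeasurableSet S :=
    ((Metric.isOpen_ball.preimage continuous_fst).inter (isOpen_lt
      (f := fun q : F × F => dist q.2 q.1) (by fun_prop) continuous_const)).measurableSet
  have hint : Integrable (S.indicator fun q => g q.2) (μ.prod μ) := by
    have h1 : Integrable (fun q : F × F => (Metric.ball a s).indicator (fun _ => (1 : ℝ)) q.1 *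
        g q.2) (μ.prod μ) := by
      refine Integrable.mul_prod (f := (Metric.ball a s).indicator fun _ => (1 : ℝ)) ?_ hg
      exact (integrableOn_const measure_ball_lt_top.ne).integrable_indicator
        Metric.isOpen_ball.measurableSet
    refine (h1.indicator hSm).congr (ae_of_all _ fun q => ?_)
    by_cases hq : q ∈ S
    · simp only [indicator_of_mem hq, indicator_of_mem hq.1, one_mul]
    · simp only [indicator_of_notMem hq]
  calc _ = ∫ x, ∫ z, S.indicator (fun q => g q.2) (x, z) ∂μ ∂μ := by
        rw [← integral_indicator Metric.isOpen_ball.measurableSet]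
        congr 1 with x
        by_cases hx : x ∈ Metric.ball a s
        · rw [indicator_of_mem hx, ← integral_indicator Metric.isOpen_ball.measurableSet]
          congr 1 with z
          by_cases hz : z ∈ Metric.ball x r
          · rw [indicator_of_mem hz, indicator_of_mem (show (x, z) ∈ S from ⟨hx, hz⟩)]
          · rw [indicator_of_notMem hz, indicator_of_notMem (fun h : (x, z) ∈ S => hz h.2)]
        · rw [indicator_of_notMem hx]
          symm
          refine integral_eq_zero_of_ae (ae_of_all _ fun z => ?_)
          exact indicator_of_notMem (fun h : (x, z) ∈ S => hx h.1) _
    _ = ∫ z, ∫ x, S.indicator (fun q => g q.2) (x, z) ∂μ ∂μ := integral_integral_swap hint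
    _ = _ := by
        congr 1 with z
        have : (fun x => S.indicator (fun q => g q.2) (x, z)) =
            (Metric.ball a s ∩ Metric.ball z r).indicator fun _ => g z := by
          ext x
          have : (x, z) ∈ S ↔ x ∈ Metric.ball a s ∩ Metric.ball z r := by
            simp [hS, dist_comm]
          by_cases h : (x, z) ∈ S
          · rw [indicator_of_mem h, indicator_of_mem (this.1 h)]
          · rw [indicator_of_notMem h, indicator_of_notMem (mt this.2 h)]
        rw [this, integral_indicator (Metric.isOpen_ball.inter Metric.isOpen_ball).measurableSet,
          setIntegral_const, smul_eq_mul, mul_comm]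

/-- By Fubini, each iterated integral is `f` against the measure of an intersection of balls, and
that measure is symmetric in the two radii. -/
theorem setAverage_ball_setAverage_ball_comm {f : F → ℝ} {a : F} {r s R : ℝ} (hR : s + r ≤ R)
    (hf : IntegrableOn f (Metric.ball a R) μ) :
    ⨍ x in Metric.ball a s, ⨍ z in Metric.ball x r, f z ∂μ ∂μ =
      ⨍ x in Metric.ball a r, ⨍ z in Metric.ball x s, f z ∂μ ∂μ := by
  set g := (Metric.ball a R).indicator f with hgdef
  have hg : Integrable g μ := hf.integrable_indicator Metric.isOpen_ball.measurableSet
  have key : ∀ s r, s + r ≤ R → ∫ x in Metric.ball a s, ∫ z in Metric.ball x r, f z ∂μ ∂μ =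
      ∫ z, g z * μ.real (Metric.ball a s ∩ Metric.ball z r) ∂μ := by
    intro s r hR
    rw [← integral_ball_integral_ball hg]
    refine setIntegral_congr_fun Metric.isOpen_ball.measurableSet fun x hx => ?_
    refine setIntegral_congr_fun Metric.isOpen_ball.measurableSet fun z hz => ?_
    rw [hgdef, indicator_of_mem]
    rw [Metric.mem_ball] at *
    linarith [dist_triangle z x a]
  simp only [setAverage_ball_eq, integral_const_mul]
  rw [key s r hR, key r s (by linarith)]
  simp only [measureReal_def, measure_ball_inter_ball_comm a _ r s]
  ring

/-- Ball means of a function whose ball means increase with the radius satisfy the sub-mean value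
inequality. -/
theorem setAverage_ball_le_setAverage_ball {f : F → ℝ} {a : F} {r s R : ℝ} (hr : 0 < r)
    (hs : 0 < s) (hR : s + r < R) (hf : IntegrableOn f (Metric.ball a R) μ)
    (hmono : ∀ x r₁ r₂, 0 < r₁ → r₁ ≤ r₂ → Metric.closedBall x r₂ ⊆ Metric.ball a R →
      ⨍ z in Metric.ball x r₁, f z ∂μ ≤ ⨍ z in Metric.ball x r₂, f z ∂μ) :
    ⨍ z in Metric.ball a r, f z ∂μ ≤
      ⨍ x in Metric.ball a s, ⨍ z in Metric.ball x r, f z ∂μ ∂μ := by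
  have hint : ∀ s r, 0 < s → 0 < r → s + r < R →
      IntegrableOn (fun x => ⨍ z in Metric.ball x r, f z ∂μ) (Metric.ball a s) μ := by
    intro s r hs hr hR
    refine IntegrableOn.mono_set (ContinuousOn.integrableOn_compact
      (isCompact_closedBall a s) fun x hx => ?_) Metric.ball_subset_closedBall
    refine (continuousAt_setAverage_ball (R := R - s) hr (by linarith)
      (hf.mono_set ?_)).continuousWithinAt
    refine Metric.ball_subset_ball' ?_
    linarith [Metric.mem_closedBall.1 hx]
  -- The left side is the limit of its own means over radius `t → 0`. Exchanging the two averages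
  -- puts `t` inside, where `hmono` raises it to `s`.
  refine le_of_tendsto (tendsto_setAverage_ball (μ := μ)
    (continuousAt_setAverage_ball hr (by linarith) hf) hs (hint s r hs hr hR)) ?_
  filter_upwards [Ioo_mem_nhdsGT hs] with t ht
  rw [setAverage_ball_setAverage_ball_comm (R := R) (by linarith [ht.2]) hf,
    setAverage_ball_setAverage_ball_comm hR.le hf, setAverage_ball_eq, setAverage_ball_eq _ a r]
  refine mul_le_mul_of_nonneg_left ?_ (by positivity)
  refine setIntegral_mono_on (hint r t hr ht.1 (by linarith [ht.2]))
    (hint r s hr hs (by linarith)) Metric.isOpen_ball.measurableSet fun x hx => ?_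
  refine hmono x t s ht.1 ht.2.le fun z hz => ?_
  rw [Metric.mem_ball] at *
  rw [Metric.mem_closedBall] at hz
  linarith [dist_triangle z x a]

end ballAverage

/-! ### Means over products. -/

section prodAverage

variable {F G : Type*} [NormedAddCommGroup F] [NormedSpace ℝ F] [FiniteDimensional ℝ F]
  [MeasurableSpace F] [BorelSpace F] {μ : Measure F} [μ.IsAddHaarMeasure]
  [NormedAddCommGroup G] [NormedSpace ℝ G] [FiniteDimensional ℝ G]
  [MeasurableSpace G] [BorelSpace G] {ν : Measure G} [ν.IsAddHaarMeasure]

theorem setAverage_prod_eq {u : F × G → ℝ} {S : Set F} {T : Set G}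
    (hu : IntegrableOn u (S ×ˢ T) (μ.prod ν)) :
    ⨍ z in S ×ˢ T, u z ∂(μ.prod ν) = ⨍ x in S, ⨍ y in T, u (x, y) ∂ν ∂μ := by
  simp only [setAverage_eq, smul_eq_mul, integral_const_mul]
  rw [measureReal_prod_prod, setIntegral_prod u hu]
  ring

/-- Averaging over `T` first leaves a function of `x` alone, to which
`setAverage_ball_le_setAverage_ball` applies. -/
theorem setAverage_prod_ball_le {u : F × G → ℝ} {a : F} {T : Set G} {r s R : ℝ} (hr : 0 < r)
    (hs : 0 < s) (hR : s + r < R) (hu : IntegrableOn u (Metric.ball a R ×ˢ T) (μ.prod ν))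
    (hmono : ∀ x r₁ r₂, 0 < r₁ → r₁ ≤ r₂ → Metric.closedBall x r₂ ⊆ Metric.ball a R →
      ⨍ z in Metric.ball x r₁ ×ˢ T, u z ∂(μ.prod ν) ≤
        ⨍ z in Metric.ball x r₂ ×ˢ T, u z ∂(μ.prod ν)) :
    ⨍ z in Metric.ball a r ×ˢ T, u z ∂(μ.prod ν) ≤
      ⨍ x in Metric.ball a s, ⨍ z in Metric.ball x r ×ˢ T, u z ∂(μ.prod ν) ∂μ := by
  have heq : ∀ x r, Metric.ball x r ⊆ Metric.ball a R →
      ⨍ z in Metric.ball x r ×ˢ T, u z ∂(μ.prod ν) =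
        ⨍ x in Metric.ball x r, ⨍ y in T, u (x, y) ∂ν ∂μ := fun x r h =>
    setAverage_prod_eq (hu.mono_set (prod_mono_left h))
  have hv : IntegrableOn (fun x => ⨍ y in T, u (x, y) ∂ν) (Metric.ball a R) μ := by
    simp only [setAverage_eq, smul_eq_mul]
    rw [IntegrableOn, ← Measure.prod_restrict] at hu
    exact hu.integral_prod_left.const_mul _
  have h := setAverage_ball_le_setAverage_ball hr hs hR hv fun x r₁ r₂ h1 h2 h3 => by
    have h4 := Metric.ball_subset_closedBall.trans h3
    rw [← heq x r₁ ((Metric.ball_subset_ball h2).trans h4), ← heq x r₂ h4]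
    exact hmono x r₁ r₂ h1 h2 h3
  rw [heq a r (Metric.ball_subset_ball (by linarith))]
  refine h.trans_eq ?_
  rw [setAverage_eq, setAverage_eq]
  congr 1
  refine setIntegral_congr_fun Metric.isOpen_ball.measurableSet fun x hx => ?_
  refine (heq x r (Metric.ball_subset_ball' ?_)).symm
  linarith [Metric.mem_ball.1 hx]

theorem setAverage_prod_swap (u : F × G → ℝ) (S : Set F) (T : Set G) :
    ⨍ z in T ×ˢ S, u z.swap ∂(ν.prod μ) = ⨍ z in S ×ˢ T, u z ∂(μ.prod ν) := by
  rw [setAverage_eq, setAverage_eq, measureReal_prod_prod, measureReal_prod_prod, mul_comm,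
    setIntegral_prod_swap]

end prodAverage

/-! ### The envelope of ball means. -/

section envelope

variable {Z : Type*} [NormedAddCommGroup Z] [NormedSpace ℝ Z] [FiniteDimensional ℝ Z]
  [MeasurableSpace Z] [BorelSpace Z] (μ : Measure Z) [μ.IsAddHaarMeasure]

/-- The infimum of the ball means of `u` over the balls whose closure lies in `U`. -/
noncomputable def meanEnvelope (u : Z → ℝ) (U : Set Z) (z : Z) : EReal :=
  ⨅ r : {r : ℝ // 0 < r ∧ Metric.closedBall z r ⊆ U},
    ((⨍ x in Metric.ball z r, u x ∂μ : ℝ) : EReal)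

variable {μ} {u : Z → ℝ} {U : Set Z}

theorem meanEnvelope_le {z : Z} {r : ℝ} (hr : 0 < r) (hz : Metric.closedBall z r ⊆ U) :
    meanEnvelope μ u U z ≤ ((⨍ x in Metric.ball z r, u x ∂μ : ℝ) : EReal) :=
  iInf_le (fun r : {r : ℝ // 0 < r ∧ Metric.closedBall z r ⊆ U} =>
    ((⨍ x in Metric.ball z r, u x ∂μ : ℝ) : EReal)) ⟨r, hr, hz⟩

theorem meanEnvelope_lt_top (hU : IsOpen U) {z : Z} (hz : z ∈ U) : meanEnvelope μ u U z < ⊤ := by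
  obtain ⟨r, hr, h⟩ := Metric.nhds_basis_closedBall.mem_iff.1 (hU.mem_nhds hz)
  exact (meanEnvelope_le hr h).trans_lt (EReal.coe_lt_top _)

/-- A radius admissible at `z` remains admissible nearby, and the mean at that radius is continuous
there, so the infimum stays below `c`. -/
theorem upperSemicontinuousAt_meanEnvelope (hU : IsOpen U) (hu : LocallyIntegrableOn u U μ)
    {z : Z} : UpperSemicontinuousAt (meanEnvelope μ u U) z := by
  intro c hc
  rw [meanEnvelope, iInf_lt_iff] at hc
  obtain ⟨⟨r, hr, hrU⟩, hlt⟩ := hc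
  obtain ⟨δ, hδ, hδU⟩ := (isCompact_closedBall z r).exists_cthickening_subset_open hU hrU
  rw [cthickening_closedBall hδ.le hr.le] at hδU
  have hcont : ContinuousAt (fun x => ⨍ y in Metric.ball x r, u y ∂μ) z :=
    continuousAt_setAverage_ball (R := δ + r) hr (by linarith)
      (((hu.mono_set hδU).integrableOn_isCompact (isCompact_closedBall _ _)).mono_set
        Metric.ball_subset_closedBall)
  have hcont' := (continuous_coe_real_ereal.continuousAt.comp hcont).eventually_lt_const hlt
  filter_upwards [hcont', Metric.ball_mem_nhds z hδ] with x hx hxz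
  refine (meanEnvelope_le hr ((Metric.closedBall_subset_closedBall' ?_).trans hδU)).trans_lt hx
  linarith [Metric.mem_ball.1 hxz]

/-- The family of ball means of `u` inside `U` increases with the radius. -/
def BallMeansMono (μ : Measure Z) (u : Z → ℝ) (U : Set Z) : Prop :=
  ∀ z r₁ r₂, 0 < r₁ → r₁ ≤ r₂ → Metric.closedBall z r₂ ⊆ U →
    ⨍ x in Metric.ball z r₁, u x ∂μ ≤ ⨍ x in Metric.ball z r₂, u x ∂μ

theorem meanEnvelope_eq_of_continuousAt (hU : IsOpen U) (hu : LocallyIntegrableOn u U μ)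
    (hmono : BallMeansMono μ u U) {z : Z} (hz : z ∈ U) (hc : ContinuousAt u z) :
    meanEnvelope μ u U z = u z := by
  obtain ⟨R, hR, hRU⟩ := Metric.nhds_basis_closedBall.mem_iff.1 (hU.mem_nhds hz)
  have hlim := tendsto_setAverage_ball (μ := μ) hc hR
    (((hu.mono_set hRU).integrableOn_isCompact (isCompact_closedBall _ _)).mono_set
      Metric.ball_subset_closedBall)
  apply le_antisymm
  · refine ge_of_tendsto (continuous_coe_real_ereal.continuousAt.tendsto.comp hlim) ?_
    filter_upwards [Ioo_mem_nhdsGT hR] with r hr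
    exact meanEnvelope_le hr.1 ((Metric.closedBall_subset_closedBall hr.2.le).trans hRU)
  · refine le_iInf fun r => ?_
    rw [EReal.coe_le_coe_iff]
    refine le_of_tendsto hlim ?_
    filter_upwards [Ioo_mem_nhdsGT r.2.1] with t ht
    exact hmono z t r ht.1 ht.2.le r.2.2

/-- By monotonicity only small radii matter, so one sequence of radii, independent of the point,
computes the envelope on a whole ball. -/
theorem meanEnvelope_eq_iInf (hmono : BallMeansMono μ u U) {z : Z} {ε : ℕ → ℝ}
    (hε : ∀ k, 0 < ε k) (hlim : Tendsto ε atTop (𝓝 0))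
    (hεU : ∀ k, Metric.closedBall z (ε k) ⊆ U) :
    meanEnvelope μ u U z = ⨅ k, ((⨍ x in Metric.ball z (ε k), u x ∂μ : ℝ) : EReal) := by
  refine le_antisymm (le_iInf fun k => meanEnvelope_le (hε k) (hεU k)) (le_iInf fun r => ?_)
  obtain ⟨k, hk⟩ := (hlim.eventually_lt_const r.2.1).exists
  exact (iInf_le _ k).trans (EReal.coe_le_coe_iff.2 (hmono z _ _ (hε k) hk.le r.2.2))

end envelope

/-! ### Decreasing limits and subharmonicity of slices. -/

/-- The sub-mean value inequality passes to decreasing limits. -/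
theorem le_ballMean_of_antitone {n : ℕ} {a : EuclideanSpace ℝ (Fin n)} {r : ℝ} (hr : 0 < r)
    {f : ℕ → EuclideanSpace ℝ (Fin n) → ℝ} {W : EuclideanSpace ℝ (Fin n) → EReal}
    (hf : ∀ k, IntegrableOn (f k) (Metric.ball a r))
    (hanti : ∀ z ∈ Metric.ball a r, Antitone fun k => f k z)
    (hW : ∀ z ∈ Metric.ball a r, W z = ⨅ k, (f k z : EReal))
    (hmean : ∀ k, f k a ≤ ⨍ z in Metric.ball a r, f k z) :
    W a ≤ ballMean W a r := by
  have hr0 : volume (Metric.ball a r) ≠ 0 := (Metric.measure_ball_pos volume a hr).ne'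
  have hlimW : ∀ z ∈ Metric.ball a r, Tendsto (fun k => (f k z : EReal)) atTop (𝓝 (W z)) := by
    intro z hz
    rw [hW z hz]
    exact tendsto_atTop_iInf fun i j hij => EReal.coe_le_coe_iff.2 (hanti z hz hij)
  have hmem : ∀ᵐ z ∂(volume.restrict (Metric.ball a r)), z ∈ Metric.ball a r :=
    ae_restrict_mem Metric.isOpen_ball.measurableSet
  have hmeas : ∀ k, AEMeasurable (fun z => (f k z : EReal))
      (volume.restrict (Metric.ball a r)) := fun k =>
    measurable_coe_real_ereal.comp_aemeasurable (hf k).aemeasurable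
  have hfin : ∀ k, ∫⁻ z in Metric.ball a r, (f k z : EReal).toENNReal ≠ ⊤ := by
    intro k
    refine ne_top_of_le_ne_top (hf k).2.ne (lintegral_mono fun z => ?_)
    rw [EReal.toENNReal_of_ne_top (EReal.coe_ne_top _), ← ofReal_norm]
    exact ENNReal.ofReal_le_ofReal (le_abs_self _)
  have hP : Tendsto (fun k => ∫⁻ z in Metric.ball a r, (f k z : EReal).toENNReal) atTop
      (𝓝 (∫⁻ z in Metric.ball a r, (W z).toENNReal)) := by
    refine lintegral_tendsto_of_tendsto_of_antitone
      (fun k => measurable_ereal_toENNReal.comp_aemeasurable (hmeas k)) ?_ (hfin 0) ?_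
    · filter_upwards [hmem] with z hz i j hij
      exact EReal.toENNReal_le_toENNReal (EReal.coe_le_coe_iff.2 (hanti z hz hij))
    · filter_upwards [hmem] with z hz
      exact (EReal.continuous_toENNReal.tendsto _).comp (hlimW z hz)
  have hN : Tendsto (fun k => ∫⁻ z in Metric.ball a r, (-(f k z : EReal)).toENNReal) atTop
      (𝓝 (∫⁻ z in Metric.ball a r, (-(W z)).toENNReal)) := by
    refine lintegral_tendsto_of_tendsto_of_monotone
      (fun k => measurable_ereal_toENNReal.comp_aemeasurable (hmeas k).neg) ?_ ?_
    · filter_upwards [hmem] with z hz i j hij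
      exact EReal.toENNReal_le_toENNReal
        (EReal.neg_le_neg_iff.2 (EReal.coe_le_coe_iff.2 (hanti z hz hij)))
    · filter_upwards [hmem] with z hz
      exact (EReal.continuous_toENNReal.tendsto _).comp
        ((continuous_neg.tendsto _).comp (hlimW z hz))
  have hlim : Tendsto (fun k => ballMean (fun z => (f k z : EReal)) a r) atTop
      (𝓝 (ballMean W a r)) := by
    simp only [ballMean, setLAverage_eq, sub_eq_add_neg]
    have h1 := (continuous_coe_ennreal_ereal.tendsto _).comp
      (ENNReal.Tendsto.div_const hP (Or.inr hr0))
    have h2 := (continuous_neg.tendsto _).comp ((continuous_coe_ennreal_ereal.tendsto _).comp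
      (ENNReal.Tendsto.div_const hN (Or.inr hr0)))
    -- The positive parts are dominated by that of `f 0`, so their limit is finite and `∞ - ∞`
    -- cannot occur; the negative parts may tend to `∞`.
    refine (EReal.continuousAt_add (p := (_, _)) ?_ ?_).tendsto.comp (h1.prodMk_nhds h2)
    · left
      have h3 : ∫⁻ z in Metric.ball a r, (W z).toENNReal ≠ ⊤ := by
        refine ne_top_of_le_ne_top (hfin 0) (lintegral_mono_ae ?_)
        filter_upwards [hmem] with z hz
        rw [hW z hz]
        exact EReal.toENNReal_le_toENNReal (iInf_le _ 0)
      simpa using ENNReal.div_ne_top h3 hr0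
    · left
      exact EReal.coe_ennreal_ne_bot _
  refine ge_of_tendsto hlim (Eventually.of_forall fun k => ?_)
  rw [ballMean_coe hr (hf k), hW a (Metric.mem_ball_self hr)]
  exact (iInf_le _ k).trans (EReal.coe_le_coe_iff.2 (hmean k))

section slices

variable {p q : ℕ}

instance : (volume : Measure (EuclideanSpace ℝ (Fin p) × EuclideanSpace ℝ (Fin q))).IsAddHaarMeasure :=
  inferInstanceAs (Measure.prod volume volume).IsAddHaarMeasure

/-- If the averages over products of balls increase with the radius of the first factor, then
`meanEnvelope` is subharmonic in the first variable. -/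
theorem subharmonicOn_meanEnvelope_left
    {u : EuclideanSpace ℝ (Fin p) × EuclideanSpace ℝ (Fin q) → ℝ}
    {U : Set (EuclideanSpace ℝ (Fin p) × EuclideanSpace ℝ (Fin q))} (hU : IsOpen U)
    (hu : LocallyIntegrableOn u U) (hmono : BallMeansMono volume u U)
    (hleft : ∀ x y r₁ r₂ s, 0 < r₁ → r₁ ≤ r₂ → 0 < s →
      Metric.closedBall x r₂ ×ˢ Metric.closedBall y s ⊆ U →
      ⨍ z in Metric.ball x r₁ ×ˢ Metric.ball y s, u z ≤
        ⨍ z in Metric.ball x r₂ ×ˢ Metric.ball y s, u z)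
    (y : EuclideanSpace ℝ (Fin q)) :
    SubharmonicOn (fun x => meanEnvelope volume u U (x, y)) {x | (x, y) ∈ U} where
  lt_top x hx := meanEnvelope_lt_top hU hx
  upperSemicontinuousOn x _ := by
    refine UpperSemicontinuousAt.upperSemicontinuousWithinAt _ fun c hc => ?_
    exact (Continuous.prodMk_left y).continuousAt.eventually
      (upperSemicontinuousAt_meanEnvelope hU hu c hc)
  le_ballMean a s hs hsU := by
    -- The slice only provides `closedBall a s × {y}` inside `U`; compactness gives room `ε` in both
    -- variables.
    obtain ⟨V, V', hV, hV', hsV, hyV', hVU⟩ := generalized_tube_lemma (isCompact_closedBall a s)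
      (isCompact_singleton (x := y)) hU (by
        rintro ⟨x, y'⟩ ⟨hx, rfl⟩
        exact hsU hx)
    obtain ⟨ε₁, hε₁, hε₁V⟩ := (isCompact_closedBall a s).exists_cthickening_subset_open hV hsV
    rw [cthickening_closedBall hε₁.le hs.le] at hε₁V
    obtain ⟨ε₂, hε₂, hε₂V'⟩ := Metric.nhds_basis_closedBall.mem_iff.1
      (hV'.mem_nhds (hyV' rfl))
    set ε := min ε₁ ε₂ with hεdef
    have hε : 0 < ε := lt_min hε₁ hε₂
    have hεU : Metric.closedBall a (s + ε) ×ˢ Metric.closedBall y ε ⊆ U := by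
      refine (Set.prod_mono ?_ ?_).trans hVU
      · refine (Metric.closedBall_subset_closedBall ?_).trans hε₁V
        linarith [min_le_left ε₁ ε₂]
      · exact (Metric.closedBall_subset_closedBall (min_le_right _ _)).trans hε₂V'
    have hεx : ∀ x ∈ Metric.closedBall a s, Metric.closedBall (x, y) ε ⊆ U := fun x hx => by
      rw [← closedBall_prod_same]
      refine (Set.prod_mono_left (Metric.closedBall_subset_closedBall' ?_)).trans hεU
      linarith [Metric.mem_closedBall.1 hx]
    -- The shift by `2` keeps every `δ k`, including `δ 0`, strictly below `ε`, leaving a larger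
    -- ball for the continuity of the means.
    set δ : ℕ → ℝ := fun k => ε / (k + 2) with hδdef
    have hδ : ∀ k, 0 < δ k := fun k => by positivity
    have hδε : ∀ k, δ k < ε := fun k => by
      rw [hδdef]
      exact div_lt_self hε (by linarith [(Nat.cast_nonneg k : (0 : ℝ) ≤ k)])
    have hδlim : Tendsto δ atTop (𝓝 0) :=
      tendsto_const_nhds.div_atTop
        (tendsto_atTop_add_const_right _ _ tendsto_natCast_atTop_atTop)
    have hint : ∀ x ∈ Metric.closedBall a s, IntegrableOn u (Metric.ball (x, y) ε) :=
      fun x hx => ((hu.mono_set (hεx x hx)).integrableOn_isCompact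
        (isCompact_closedBall _ _)).mono_set Metric.ball_subset_closedBall
    refine le_ballMean_of_antitone (W := fun x => meanEnvelope volume u U (x, y)) hs
      (f := fun k x => ⨍ z in Metric.ball (x, y) (δ k), u z) (fun k => ?_) (fun x hx i j hij => ?_)
      (fun x hx => ?_) (fun k => ?_)
    · refine IntegrableOn.mono_set (ContinuousOn.integrableOn_compact
        (isCompact_closedBall a s) fun x hx => ?_) Metric.ball_subset_closedBall
      have h1 : ContinuousAt (fun z => ⨍ z' in Metric.ball z (δ k), u z') (x, y) :=
        continuousAt_setAverage_ball (hδ k) (hδε k) (hint x hx)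
      exact (ContinuousAt.comp (f := fun x => (x, y)) h1
        (Continuous.prodMk_left y).continuousAt).continuousWithinAt
    · refine hmono (x, y) (δ j) (δ i) (hδ j) ?_ ((Metric.closedBall_subset_closedBall
        (hδε i).le).trans (hεx x (Metric.ball_subset_closedBall hx)))
      simp only [hδdef]
      gcongr
    · exact meanEnvelope_eq_iInf hmono hδ hδlim fun k => (Metric.closedBall_subset_closedBall
        (hδε k).le).trans (hεx x (Metric.ball_subset_closedBall hx))
    -- Balls of the sup metric are products, so the sub-mean value inequality in `x` applies with
    -- the second factor `Metric.ball y (δ k)` fixed.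
    · simp only [← ball_prod_same]
      have hδy := Metric.closedBall_subset_closedBall (x := y) (hδε k).le
      refine setAverage_prod_ball_le (R := s + ε) (hδ k) hs (by linarith [hδε k]) ?_ ?_
      · exact ((hu.mono_set hεU).integrableOn_isCompact
          ((isCompact_closedBall _ _).prod (isCompact_closedBall _ _))).mono_set
          (Set.prod_mono Metric.ball_subset_closedBall (Metric.ball_subset_closedBall.trans hδy))
      · intro x r₁ r₂ h1 h2 hsub
        exact hleft x y r₁ r₂ (δ k) h1 h2 (hδ k) ((Set.prod_mono
          (hsub.trans Metric.ball_subset_closedBall) hδy).trans hεU)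

theorem meanEnvelope_swap (u : EuclideanSpace ℝ (Fin p) × EuclideanSpace ℝ (Fin q) → ℝ)
    (U : Set (EuclideanSpace ℝ (Fin p) × EuclideanSpace ℝ (Fin q)))
    (z : EuclideanSpace ℝ (Fin q) × EuclideanSpace ℝ (Fin p)) :
    meanEnvelope volume (fun z => u z.swap) (Prod.swap ⁻¹' U) z =
      meanEnvelope volume u U z.swap := by
  obtain ⟨y, x⟩ := z
  have h1 : ∀ r, Metric.closedBall (y, x) r ⊆ Prod.swap ⁻¹' U ↔
      Metric.closedBall (x, y) r ⊆ U := by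
    intro r
    rw [← closedBall_prod_same, ← closedBall_prod_same, ← image_subset_iff, image_swap_prod]
  have h2 : ∀ r, ⨍ z in Metric.ball (y, x) r, u z.swap = ⨍ z in Metric.ball (x, y) r, u z := by
    intro r
    rw [← ball_prod_same, ← ball_prod_same]
    exact setAverage_prod_swap u _ _
  simp only [meanEnvelope, iInf_subtype, h1, h2, Prod.swap_prod_mk]

end slices

end SepSubharmonic

/-! ### The extension theorem. -/

open SepSubharmonic in
theorem corollary4 (p q : ℕ) (hp : 2 ≤ p) (hq : 2 ≤ q)
    (Ω E : Set (EuclideanSpace ℝ (Fin (p + q))))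
    (hΩ_open : IsOpen Ω) (hΩ_conn : IsConnected Ω)
    (hE_sub : E ⊆ Ω) (hE_closed : IsClosed ((↑) ⁻¹' E : Set Ω))
    (hE_null : Measure.hausdorffMeasure ((p : ℝ) + (q : ℝ) - 1) E = 0)
    (w : EuclideanSpace ℝ (Fin (p + q)) → ℝ)
    (hw_sub : SepSubharmonic.SeparatelySubharmonicOn p q (fun z => (w z : EReal)) (Ω \ E))
    (hw_loc : LocallyIntegrableOn w Ω volume)
    (hw_C2 : ContDiffOn ℝ 2 w (Ω \ E))
    (hw_dd : ∀ i : Fin (p + q), LocallyIntegrableOn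
      (SepSubharmonic.partialDeriv i (SepSubharmonic.partialDeriv i w)) Ω volume) :
    ∃ W : EuclideanSpace ℝ (Fin (p + q)) → EReal,
      (∀ z ∈ Ω \ E, W z = (w z : EReal)) ∧
      SepSubharmonic.SeparatelySubharmonicOn p q W Ω := by
  have hΩE : IsOpen (Ω \ E) := by
    have h1 := hΩ_open.isOpenMap_subtype_val _ hE_closed.isOpen_compl
    rwa [← preimage_compl, Subtype.image_preimage_coe] at h1
  have hp0 : 0 < p := by lia
  have hq0 : 0 < q := by lia
  set j := joinHomeomorph p q
  set U := j ⁻¹' Ω with hUdef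
  set u : EuclideanSpace ℝ (Fin p) × EuclideanSpace ℝ (Fin q) → ℝ := fun z => w (join z.1 z.2)
    with hudef
  have hU : IsOpen U := hΩ_open.preimage j.continuous
  have hu : LocallyIntegrableOn u U := locallyIntegrableOn_comp_join hw_loc
  have hleft : ∀ x y r₁ r₂ s, 0 < r₁ → r₁ ≤ r₂ → 0 < s →
      Metric.closedBall x r₂ ×ˢ Metric.closedBall y s ⊆ U →
      ⨍ z in Metric.ball x r₁ ×ˢ Metric.ball y s, u z ≤
        ⨍ z in Metric.ball x r₂ ×ˢ Metric.ball y s, u z := fun x y r₁ r₂ s h1 h2 h3 h4 =>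
    setAverage_join_mono_left hp0 hΩE hE_null hw_sub hw_loc hw_C2 hw_dd h1 h2 h3 h4
  have hright : ∀ x y r₁ r₂ s, 0 < r₁ → r₁ ≤ r₂ → 0 < s →
      Metric.closedBall x s ×ˢ Metric.closedBall y r₂ ⊆ U →
      ⨍ z in Metric.ball x s ×ˢ Metric.ball y r₁, u z ≤
        ⨍ z in Metric.ball x s ×ˢ Metric.ball y r₂, u z := fun x y r₁ r₂ s h1 h2 h3 h4 =>
    setAverage_join_mono_right hq0 hΩE hE_null hw_sub hw_loc hw_C2 hw_dd h1 h2 h3 h4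
  -- Enlarge the ball in `x` first, then the ball in `y`.
  have hmono : BallMeansMono volume u U := by
    rintro ⟨x, y⟩ r₁ r₂ h1 h2 hsub
    rw [← closedBall_prod_same] at hsub
    rw [← ball_prod_same, ← ball_prod_same]
    exact (hleft x y r₁ r₂ r₁ h1 h2 h1 ((Set.prod_mono_right
      (Metric.closedBall_subset_closedBall h2)).trans hsub)).trans
      (hright x y r₁ r₂ r₂ h1 h2 (h1.trans_le h2) hsub)
  refine ⟨fun z => meanEnvelope volume u U (j.symm z), fun z hz => ?_, fun y => ?_, fun x => ?_⟩
  · obtain ⟨z, rfl⟩ := j.surjective z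
    simp only [Homeomorph.symm_apply_apply]
    refine meanEnvelope_eq_of_continuousAt hU hu hmono hz.1 ?_
    exact (hw_C2.continuousOn.continuousAt (hΩE.mem_nhds hz)).comp j.continuous.continuousAt
  · have h := subharmonicOn_meanEnvelope_left hU hu hmono hleft y
    have hj : ∀ x, j.symm (join x y) = (x, y) := fun x => j.symm_apply_apply (x, y)
    simp only [hj]
    exact h
  -- Subharmonicity in `y` follows from the result in the first variable after exchanging the
  -- factors.
  · have hswap : MeasurePreserving
        (Prod.swap : EuclideanSpace ℝ (Fin q) × EuclideanSpace ℝ (Fin p) → _) volume volume :=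
      Measure.measurePreserving_swap
    have hu' : LocallyIntegrableOn (fun z => u (Prod.swap z)) (Prod.swap ⁻¹' U) := by
      intro z hz
      obtain ⟨t, ht, hti⟩ := hu _ hz
      exact ⟨Prod.swap ⁻¹' t, continuous_swap.continuousWithinAt.tendsto_nhdsWithin
        (mapsTo_preimage _ _) ht, (hswap.integrableOn_comp_preimage
          MeasurableEquiv.prodComm.measurableEmbedding).2 hti⟩
    have havg : ∀ (S : Set (EuclideanSpace ℝ (Fin p))) (T : Set (EuclideanSpace ℝ (Fin q))),
        ⨍ z in T ×ˢ S, u z.swap = ⨍ z in S ×ˢ T, u z := setAverage_prod_swap u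
    have h := subharmonicOn_meanEnvelope_left (hU.preimage continuous_swap) hu' ?_ ?_ x
    · have hj : ∀ y, j.symm (join x y) = (x, y) := fun y => j.symm_apply_apply (x, y)
      simp only [meanEnvelope_swap] at h
      simp only [hj]
      exact h
    · rintro ⟨y, x⟩ r₁ r₂ h1 h2 hsub
      rw [← closedBall_prod_same, ← image_subset_iff, image_swap_prod, closedBall_prod_same] at hsub
      rw [← ball_prod_same, ← ball_prod_same, havg, havg, ball_prod_same, ball_prod_same]
      exact hmono (x, y) r₁ r₂ h1 h2 hsub
    · intro y x r₁ r₂ s h1 h2 h3 hsub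
      rw [← image_subset_iff, image_swap_prod] at hsub
      rw [havg, havg]
      exact hright x y r₁ r₂ s h1 h2 h3 hsub
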